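/- Let $E$ be a tropical elliptic curve: a circle of some length $L>0$, oriented, with a finite set $V(E)$ of points chosen as vertices. A tropical cover $\pi\colon\Gamma\to E$ is a surjective map from a finite metric multigraph $\Gamma$ (loops and parallel edges allowed) with $\pi(V(\Gamma))\subset V(E)$ such that every edge $e$ is mapped linearly with positive integer slope $\omega(e)$ (its weight) in the direction of the orientation of $E$ (edges may pass over vertices of $E$ and wind around $E$), and such that at each vertex the sum of the weights of the incoming edges equals the sum of the weights of the outgoing edges. Isomorphisms and automorphisms of tropical covers are isomorphisms of metric graphs (mapping vertices to vertices and edges to edges) that commute with the maps to $E$. Valencies count loops twice, and the genus of a graph is its first Betti number. Fix a finite set $B\subset V(E)$ of branch points. A twisted tropical cover of $E$ is a tropical cover $\pi\colon\Gamma\to E$ with an involution $\iota$ of $\Gamma$ satisfying $\pi\circ\iota=\pi$ such that: over each $p\in B$ there are either exactly two vertices, both $3$-valent, or exactly one vertex, which is $4$-valent; all vertices over $V(E)\setminus B$ are $2$-valent; the edges adjacent to a $4$-valent vertex all have the same weight; and the fixed locus of $\iota$ is exactly the set of $4$-valent vertices. Isomorphisms and automorphisms of twisted tropical covers are isomorphisms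 of tropical covers that commute with the involutions. The quotient cover $\Gamma/\iota\to E$ is obtained by identifying vertices, respectively edges, that are exchanged by $\iota$, keeping lengths and weights. Let $\overline{\pi}\colon\overline{\Gamma}\to E$ be a connected tropical cover that is isomorphic to the quotient cover of some twisted tropical cover of $E$ with set of branch points $B$. Let $g'$ be the genus of $\overline{\Gamma}$ and let $c$ be the number of $2$-valent vertices of $\overline{\Gamma}$ lying over points of $B$ (these are all the $2$-valent vertices if $V(E)=B$). Then there are, up to isomorphism, only finitely many connected twisted tropical covers $\pi\colon\Gamma\to E$ with set of branch points $B$ whose quotient cover is isomorphic to $\overline{\pi}$, and $$\sum_{\pi}\frac{1}{\#\mathrm{Aut}(\pi)}=\frac{2^{g'}-\delta_{0c}}{2^{c+1}\cdot\#\mathrm{Aut}(\overline{\pi})},$$ where the sum runs over the isomorphism classes of these covers, and $\delta_{0c}=1$ if $c=0$ and $\delta_{0c}=0$ otherwise. -/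

import Mathlib

/-- A tropical elliptic curve: a circle of given positive length, with finitely many points
chosen as (two-valent) vertices. The circle `ℝ / len ℤ` carries its standard orientation. -/
structure TropicalEllipticCurve where
  len : ℝ
  len_pos : 0 < len
  verts : Finset (AddCircle len)

/-- A finite metric multigraph (loops and parallel edges are allowed), all edges of finite length.
Each edge `e` is identified with the interval `[0, length e]`, running from `src e` to `tgt e`.
For a graph covering a circle the direction of the edges is not a choice: it is pulled back from
the orientation of the circle, see `TropicalCover`. -/
structure MetricGraph where
  Vert : Type
  Edge : Type
  [fintypeVert : Fintype Vert]
  [fintypeEdge : Fintype Edge]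
  src : Edge → Vert
  tgt : Edge → Vert
  length : Edge → ℝ
  length_pos : ∀ e, 0 < length e

attribute [instance] MetricGraph.fintypeVert MetricGraph.fintypeEdge

namespace MetricGraph

/-- The valency of a vertex; a loop counts twice. -/
noncomputable def valency (Γ : MetricGraph) (v : Γ.Vert) : ℕ :=
  Nat.card {e // Γ.src e = v} + Nat.card {e // Γ.tgt e = v}

/-- The graph is nonempty and any two vertices are joined by an undirected path. -/
def Connected (Γ : MetricGraph) : Prop :=
  Nonempty Γ.Vert ∧
    ∀ v w, Relation.EqvGen (fun a b => ∃ e, Γ.src e = a ∧ Γ.tgt e = b) v w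

open Classical in
/-- The simplicial boundary operator from 1-chains to 0-chains, with rational coefficients:
at a vertex, incoming coefficients minus outgoing coefficients. -/
noncomputable def boundary (Γ : MetricGraph) : (Γ.Edge → ℚ) →ₗ[ℚ] (Γ.Vert → ℚ) where
  toFun x v := (∑ e with Γ.tgt e = v, x e) - ∑ e with Γ.src e = v, x e
  map_add' x y := by
    funext v
    simp only [Pi.add_apply, Finset.sum_add_distrib]
    ring
  map_smul' a x := by
    funext v
    simp only [Pi.smul_apply, smul_eq_mul, ← Finset.mul_sum, RingHom.id_apply]
    ring

/-- The genus of a graph: its first Betti number. -/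
noncomputable def genus (Γ : MetricGraph) : ℕ :=
  Module.finrank ℚ (LinearMap.ker Γ.boundary)

end MetricGraph

open Classical in
/-- A tropical cover of a tropical elliptic curve `E`: a finite metric graph with a surjective
harmonic map to `E`. The edge `e` is mapped by the linear map
`t ↦ proj (src e) + weight e * t`, `0 ≤ t ≤ length e`, with a positive integer slope with
respect to the orientation of `E`; edges may wind around the circle and may pass over vertices
of `E`. The edges `e` with `tgt e = v` are the incoming edges at `v`, those with
`src e = v` the outgoing ones. -/
structure TropicalCover (E : TropicalEllipticCurve) extends MetricGraph where
  weight : Edge → ℕ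
  weight_pos : ∀ e, 0 < weight e
  proj : Vert → AddCircle E.len
  proj_mem : ∀ v, proj v ∈ E.verts
  proj_tgt : ∀ e, proj (tgt e) =
    proj (src e) + ((weight e * length e : ℝ) : AddCircle E.len)
  balanced : ∀ v, ∑ e with tgt e = v, weight e = ∑ e with src e = v, weight e
  surjective : ∀ x : AddCircle E.len, ∃ e, ∃ t ∈ Set.Icc 0 (length e),
    x = proj (src e) + ((weight e * t : ℝ) : AddCircle E.len)

namespace TropicalCover

variable {E : TropicalEllipticCurve}

/-- An isomorphism of tropical covers of `E`: an isomorphism of metric graphs that commutes with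
the maps to `E`. -/
@[ext]
structure Iso (C D : TropicalCover E) where
  vert : C.Vert ≃ D.Vert
  edge : C.Edge ≃ D.Edge
  src_edge : ∀ e, D.src (edge e) = vert (C.src e)
  tgt_edge : ∀ e, D.tgt (edge e) = vert (C.tgt e)
  length_edge : ∀ e, D.length (edge e) = C.length e
  weight_edge : ∀ e, D.weight (edge e) = C.weight e
  proj_vert : ∀ v, D.proj (vert v) = C.proj v

namespace Iso

/-- The identity. -/
def refl (C : TropicalCover E) : Iso C C where
  vert := Equiv.refl _
  edge := Equiv.refl _
  src_edge _ := rfl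
  tgt_edge _ := rfl
  length_edge _ := rfl
  weight_edge _ := rfl
  proj_vert _ := rfl

/-- The inverse of an isomorphism. -/
def symm {C D : TropicalCover E} (f : Iso C D) : Iso D C where
  vert := f.vert.symm
  edge := f.edge.symm
  src_edge e := by rw [Equiv.eq_symm_apply, ← f.src_edge, Equiv.apply_symm_apply]
  tgt_edge e := by rw [Equiv.eq_symm_apply, ← f.tgt_edge, Equiv.apply_symm_apply]
  length_edge e := by rw [← f.length_edge, Equiv.apply_symm_apply]
  weight_edge e := by rw [← f.weight_edge, Equiv.apply_symm_apply]
  proj_vert v := by rw [← f.proj_vert, Equiv.apply_symm_apply]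

/-- Composition of isomorphisms. -/
def trans {C D F : TropicalCover E} (f : Iso C D) (g : Iso D F) : Iso C F where
  vert := f.vert.trans g.vert
  edge := f.edge.trans g.edge
  src_edge e := by simp [g.src_edge, f.src_edge]
  tgt_edge e := by simp [g.tgt_edge, f.tgt_edge]
  length_edge e := by simp [g.length_edge, f.length_edge]
  weight_edge e := by simp [g.weight_edge, f.weight_edge]
  proj_vert v := by simp [g.proj_vert, f.proj_vert]

end Iso

/-- The number `♯ Aut` of automorphisms of a tropical cover. -/
noncomputable def autCard (C : TropicalCover E) : ℕ := Nat.card (Iso C C)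

/-- The number of 2-valent vertices over the set `B` of branch points. (Vertices over the other
vertices of `E` merely subdivide edges; there are none if all vertices of `E` are
branch points.) -/
noncomputable def twoValentCard (C : TropicalCover E) (B : Finset (AddCircle E.len)) : ℕ :=
  Nat.card {v // C.valency v = 2 ∧ C.proj v ∈ B}

end TropicalCover

/-- A twisted tropical cover of `E` with set of branch points `B`: a tropical cover with an
involution `ι` respecting the cover. The branch points are vertices of `E`; over each of them there
are either exactly two vertices, both 3-valent, or exactly one vertex, which is 4-valent; there is
no branching over the other vertices of `E`; the edges at a 4-valent vertex have equal
weights; and the fixed locus of `ι` is the set of 4-valent vertices. (As `ι` commutes with the map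
to `E`, an edge with a fixed interior point would be fixed pointwise.) -/
structure TwistedTropicalCover (E : TropicalEllipticCurve) (B : Finset (AddCircle E.len))
    extends TropicalCover E where
  ι : TropicalCover.Iso toTropicalCover toTropicalCover
  ι_vert_ι_vert : ∀ v, ι.vert (ι.vert v) = v
  ι_edge_ι_edge : ∀ e, ι.edge (ι.edge e) = e
  branch_mem : B ⊆ E.verts
  branch : ∀ p ∈ B,
    (Nat.card {v // proj v = p} = 2 ∧ ∀ v, proj v = p → toMetricGraph.valency v = 3) ∨
    (Nat.card {v // proj v = p} = 1 ∧ ∀ v, proj v = p → toMetricGraph.valency v = 4)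
  unbranched : ∀ v, proj v ∉ B → toMetricGraph.valency v = 2
  weight_eq : ∀ v, toMetricGraph.valency v = 4 → ∀ e e', (src e = v ∨ tgt e = v) →
    (src e' = v ∨ tgt e' = v) → weight e = weight e'
  ι_vert_eq_iff : ∀ v, ι.vert v = v ↔ toMetricGraph.valency v = 4
  ι_edge_ne : ∀ e, ι.edge e ≠ e

namespace TwistedTropicalCover

variable {E : TropicalEllipticCurve} {B : Finset (AddCircle E.len)}

/-- An isomorphism of twisted tropical covers: an isomorphism of covers of `E` that commutes with
the involutions. -/
@[ext]
structure Iso (P R : TwistedTropicalCover E B) extends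
    TropicalCover.Iso P.toTropicalCover R.toTropicalCover where
  vert_ι : ∀ v, vert (P.ι.vert v) = R.ι.vert (vert v)
  edge_ι : ∀ e, edge (P.ι.edge e) = R.ι.edge (edge e)

namespace Iso

/-- The identity. -/
def refl (P : TwistedTropicalCover E B) : Iso P P where
  toIso := TropicalCover.Iso.refl _
  vert_ι _ := rfl
  edge_ι _ := rfl

/-- The inverse of an isomorphism. -/
def symm {P R : TwistedTropicalCover E B} (f : Iso P R) : Iso R P where
  toIso := f.toIso.symm
  vert_ι v := by
    change f.vert.symm _ = P.ι.vert (f.vert.symm v)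
    rw [Equiv.symm_apply_eq, f.vert_ι, Equiv.apply_symm_apply]
  edge_ι e := by
    change f.edge.symm _ = P.ι.edge (f.edge.symm e)
    rw [Equiv.symm_apply_eq, f.edge_ι, Equiv.apply_symm_apply]

/-- Composition of isomorphisms. -/
def trans {P R S : TwistedTropicalCover E B} (f : Iso P R) (g : Iso R S) : Iso P S where
  toIso := f.toIso.trans g.toIso
  vert_ι v := by
    change g.vert (f.vert _) = S.ι.vert (g.vert (f.vert v))
    rw [f.vert_ι, g.vert_ι]
  edge_ι e := by
    change g.edge (f.edge _) = S.ι.edge (g.edge (f.edge e))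
    rw [f.edge_ι, g.edge_ι]

end Iso

/-- The number `♯ Aut` of automorphisms of a twisted tropical cover (they respect the map
to `E` and the involution). -/
noncomputable def autCard (P : TwistedTropicalCover E B) : ℕ := Nat.card (Iso P P)

theorem autCard_eq_of_iso {P R : TwistedTropicalCover E B} (f : Iso P R) :
    P.autCard = R.autCard := by
  refine Nat.card_congr
    { toFun := fun g => (f.symm.trans g).trans f
      invFun := fun g => (f.trans g).trans f.symm
      left_inv := fun g => ?_
      right_inv := fun g => ?_ }
  · ext x
    · change f.vert.symm (f.vert (g.vert (f.vert.symm (f.vert x)))) = g.vert x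
      simp
    · change f.edge.symm (f.edge (g.edge (f.edge.symm (f.edge x)))) = g.edge x
      simp
  · ext x
    · change f.vert (f.vert.symm (g.vert (f.vert (f.vert.symm x)))) = g.vert x
      simp
    · change f.edge (f.edge.symm (g.edge (f.edge (f.edge.symm x)))) = g.edge x
      simp

/-- Two vertices are identified if they agree or are exchanged by the involution. -/
def vertSetoid (P : TwistedTropicalCover E B) : Setoid P.Vert where
  r v w := w = v ∨ w = P.ι.vert v
  iseqv :=
    { refl := fun _ => Or.inl rfl
      symm := by
        rintro v w (rfl | rfl)
        · exact Or.inl rfl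
        · exact Or.inr (P.ι_vert_ι_vert v).symm
      trans := by
        rintro u v w (rfl | rfl) (rfl | rfl)
        · exact Or.inl rfl
        · exact Or.inr rfl
        · exact Or.inr rfl
        · exact Or.inl (P.ι_vert_ι_vert u) }

/-- Two edges are identified if they agree or are exchanged by the involution. -/
def edgeSetoid (P : TwistedTropicalCover E B) : Setoid P.Edge where
  r e f := f = e ∨ f = P.ι.edge e
  iseqv :=
    { refl := fun _ => Or.inl rfl
      symm := by
        rintro v w (rfl | rfl)
        · exact Or.inl rfl
        · exact Or.inr (P.ι_edge_ι_edge v).symm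
      trans := by
        rintro u v w (rfl | rfl) (rfl | rfl)
        · exact Or.inl rfl
        · exact Or.inr rfl
        · exact Or.inr rfl
        · exact Or.inl (P.ι_edge_ι_edge u) }

noncomputable instance (P : TwistedTropicalCover E B) : Fintype (Quotient P.vertSetoid) :=
  Fintype.ofFinite _

noncomputable instance (P : TwistedTropicalCover E B) : Fintype (Quotient P.edgeSetoid) :=
  Fintype.ofFinite _

/-- The metric graph `Γ / ι`. -/
noncomputable def quotientGraph (P : TwistedTropicalCover E B) : MetricGraph where
  Vert := Quotient P.vertSetoid
  Edge := Quotient P.edgeSetoid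
  src := Quotient.lift (fun e => Quotient.mk P.vertSetoid (P.src e)) (by
    rintro e f (rfl | rfl)
    · rfl
    · exact Quotient.sound (Or.inr (P.ι.src_edge e)))
  tgt := Quotient.lift (fun e => Quotient.mk P.vertSetoid (P.tgt e)) (by
    rintro e f (rfl | rfl)
    · rfl
    · exact Quotient.sound (Or.inr (P.ι.tgt_edge e)))
  length := Quotient.lift P.length (by
    rintro e f (rfl | rfl)
    · rfl
    · exact (P.ι.length_edge e).symm)
  length_pos := by
    rintro ⟨e⟩
    exact P.length_pos e

/-- The weight of an edge of `Γ / ι`. -/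
def quotientWeight (P : TwistedTropicalCover E B) : P.quotientGraph.Edge → ℕ :=
  Quotient.lift P.weight (by
    rintro e f (rfl | rfl)
    · rfl
    · exact (P.ι.weight_edge e).symm)

/-- The map from `Γ / ι` to `E` on vertices. -/
def quotientProj (P : TwistedTropicalCover E B) : P.quotientGraph.Vert → AddCircle E.len :=
  Quotient.lift P.proj (by
    rintro v w (rfl | rfl)
    · rfl
    · exact (P.ι.proj_vert v).symm)

open Classical in
theorem card_edge_fiber (P : TwistedTropicalCover E B) (q : Quotient P.edgeSetoid) :
    (Finset.univ.filter fun e => Quotient.mk P.edgeSetoid e = q).card = 2 := by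
  induction q using Quotient.inductionOn with
  | h e =>
    have h : (Finset.univ.filter fun f => Quotient.mk P.edgeSetoid f = Quotient.mk _ e) =
        {e, P.ι.edge e} := by
      ext f
      simp only [Finset.mem_filter, Finset.mem_univ, true_and, Finset.mem_insert,
        Finset.mem_singleton]
      constructor
      · intro hf
        exact Quotient.exact hf.symm
      · intro hf
        exact (Quotient.sound (s := P.edgeSetoid) hf).symm
    rw [h, Finset.card_pair (P.ι_edge_ne e).symm]

open Classical in
theorem sum_edge_quotient (P : TwistedTropicalCover E B) (h : Quotient P.edgeSetoid → ℕ) :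
    ∑ e, h (Quotient.mk P.edgeSetoid e) = 2 * ∑ q, h q := by
  rw [← Finset.sum_fiberwise (s := Finset.univ) (g := fun e => Quotient.mk P.edgeSetoid e),
    Finset.mul_sum]
  refine Finset.sum_congr rfl fun q _ => ?_
  rw [Finset.sum_congr rfl (g := fun _ => h q), Finset.sum_const, P.card_edge_fiber, smul_eq_mul]
  intro e he
  rw [(Finset.mem_filter.1 he).2]

open Classical in
theorem quotient_balanced (P : TwistedTropicalCover E B) (x : P.quotientGraph.Vert) :
    ∑ e with P.quotientGraph.tgt e = x, P.quotientWeight e =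
      ∑ e with P.quotientGraph.src e = x, P.quotientWeight e := by
  have key : ∀ s : P.Edge → P.Vert,
      ∑ e, (if Quotient.mk P.vertSetoid (s e) = x then P.weight e else 0) =
        ∑ v, if Quotient.mk P.vertSetoid v = x then ∑ e with s e = v, P.weight e else 0 := by
    intro s
    rw [← Finset.sum_fiberwise (s := Finset.univ) (g := s)]
    refine Finset.sum_congr rfl fun v _ => ?_
    split_ifs with hv
    · refine Finset.sum_congr rfl fun e he => ?_
      rw [(Finset.mem_filter.1 he).2, if_pos hv]
    · refine Finset.sum_eq_zero fun e he => ?_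
      rw [(Finset.mem_filter.1 he).2, if_neg hv]
  have h1 := P.sum_edge_quotient fun q : P.quotientGraph.Edge =>
    if P.quotientGraph.tgt q = x then P.quotientWeight q else 0
  have h2 := P.sum_edge_quotient fun q : P.quotientGraph.Edge =>
    if P.quotientGraph.src q = x then P.quotientWeight q else 0
  have h3 : ∑ e, (if Quotient.mk P.vertSetoid (P.tgt e) = x then P.weight e else 0) =
      ∑ e, (if Quotient.mk P.vertSetoid (P.src e) = x then P.weight e else 0) := by
    rw [key, key]
    exact Finset.sum_congr rfl fun v _ => by rw [P.balanced v]
  rw [Finset.sum_filter, Finset.sum_filter]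
  have h4 := h1.symm.trans (h3.trans h2)
  exact Nat.eq_of_mul_eq_mul_left two_pos h4

/-- The quotient cover `Γ / ι → E` of a twisted tropical cover. -/
noncomputable def quotient (P : TwistedTropicalCover E B) : TropicalCover E where
  toMetricGraph := P.quotientGraph
  weight := P.quotientWeight
  weight_pos := by
    rintro ⟨e⟩
    exact P.weight_pos e
  proj := P.quotientProj
  proj_mem := by
    rintro ⟨v⟩
    exact P.proj_mem v
  proj_tgt := by
    rintro ⟨e⟩
    exact P.proj_tgt e
  balanced := P.quotient_balanced
  surjective := by
    intro x
    obtain ⟨e, t, ht, hx⟩ := P.surjective x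
    exact ⟨Quotient.mk _ e, t, ht, hx⟩

end TwistedTropicalCover

namespace TropicalCover

variable {E : TropicalEllipticCurve}

/-- The connected twisted tropical covers with branch points `B` whose quotient cover is
(isomorphic to) the given cover `C`. -/
def ConnectedLift (C : TropicalCover E) (B : Finset (AddCircle E.len)) :=
  {P : TwistedTropicalCover E B // P.Connected ∧ Nonempty (Iso P.quotient C)}

/-- Connected lifts are equivalent if they are isomorphic as twisted tropical covers. -/
instance connectedLiftSetoid (C : TropicalCover E) (B : Finset (AddCircle E.len)) :
    Setoid (C.ConnectedLift B) where
  r P R := Nonempty (TwistedTropicalCover.Iso P.1 R.1)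
  iseqv :=
    { refl := fun P => ⟨TwistedTropicalCover.Iso.refl P.1⟩
      symm := fun ⟨f⟩ => ⟨f.symm⟩
      trans := fun ⟨f⟩ ⟨g⟩ => ⟨f.trans g⟩ }

/-- The isomorphism classes of connected twisted tropical covers with quotient cover `C`. -/
def ConnectedLiftClass (C : TropicalCover E) (B : Finset (AddCircle E.len)) :=
  Quotient (C.connectedLiftSetoid B)

/-- The number of automorphisms of (any representative of) an isomorphism class. -/
noncomputable def ConnectedLiftClass.autCard {C : TropicalCover E} {B : Finset (AddCircle E.len)} :
    C.ConnectedLiftClass B → ℕ :=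
  Quotient.lift (fun P => P.1.autCard) fun _ _ ⟨f⟩ => TwistedTropicalCover.autCard_eq_of_iso f

end TropicalCover

/-! Write `C` for the quotient cover, `c` for the number of its 2-valent vertices over `B`, and V, E
for its numbers of vertices and edges. Such vertices are called ramified: they are exactly the
vertices below fixed points of the involution (`ι_vert_eq_iff_ramified`). So where a lift branches
is dictated by `C`. A lift has one sheet over each ramified vertex and two over every other vertex
and every edge. Once sheets are numbered, what remains is a `Gluing`: for both ends of each edge,
the sheet over the end vertex to which sheet zero of the edge is attached.

A `Marking` of a lift `P` is an identification of its quotient with `C` together with a choice of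
zero sheets. Markings of `P` correspond to pairs of a gluing and an isomorphism from its cover to
`P`. Counting these pairs in two ways gives (gluings yielding `P`) · #Aut `P` = #Aut `C` · 2^(V-c) ·
2^E (`card_gluing_mul_autCard`). Hence the required sum is the number of connected gluings divided
by #Aut `C` · 2^(V-c+E) (`sum_connectedLiftClass`).

A ramified vertex has one incoming and one outgoing edge, so there are 2^(2E-2c) gluings
(`card_gluing`). If c > 0, a fixed vertex forces every lift to be connected
(`connected_of_ramified`). As g' = E-V+1, the sum is 2^(g'-1-c) / #Aut `C`. If c = 0, the
disconnected gluings are those obtained from the trivial one by renumbering sheets. They form the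
image of a homomorphism from (ℤ/2)^V × (ℤ/2)^E whose kernel consists of the constants, so there are
2^(V+E-1) of them (`card_not_connected`). They account for the correction -1 in the numerator. -/

/-! ### Sums over fibers of quotients by involutions, and valencies -/

open Classical in
/-- Summing a function pulled back along the quotient by a free involution. -/
theorem Finset.sum_comp_of_free_involution {α β : Type*} [Fintype α] [Fintype β] {ι : α → α}
    {p : α → β} (free : ∀ a, ι a ≠ a) (hp : ∀ a b, p a = p b ↔ b = a ∨ b = ι a)
    (surj : Function.Surjective p) (h : β → ℕ) : ∑ a, h (p a) = 2 * ∑ b, h b := by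
  rw [← Finset.sum_fiberwise (s := Finset.univ) (g := p), Finset.mul_sum]
  refine Finset.sum_congr rfl fun b _ => ?_
  obtain ⟨a, rfl⟩ := surj b
  have : (Finset.univ.filter fun x => p x = p a) = {a, ι a} := by
    ext x
    simp only [Finset.mem_filter, Finset.mem_univ, true_and, Finset.mem_insert,
      Finset.mem_singleton]
    rw [eq_comm, hp]
  rw [this, Finset.sum_pair (free a).symm, ← (hp a (ι a)).2 (Or.inr rfl), two_mul]

open Classical in
/-- Local degrees of an equivariant map over a map of quotients by involutions, where the
involution on the source is free. -/
theorem Finset.sum_fiber_of_involution {α β γ δ : Type*} [Fintype α] [Fintype β]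
    {ι : α → α} {κ : γ → γ} {p : α → β} {q : γ → δ} {s : α → γ} {r : β → δ}
    (invol : ∀ a, ι (ι a) = a) (invol' : ∀ c, κ (κ c) = c)
    (free : ∀ a, ι a ≠ a) (hp : ∀ a b, p a = p b ↔ b = a ∨ b = ι a)
    (surj : Function.Surjective p) (hq : ∀ a b, q a = q b ↔ b = a ∨ b = κ a)
    (hs : ∀ a, s (ι a) = κ (s a)) (hr : ∀ a, q (s a) = r (p a)) (h : β → ℕ) (w : γ) :
    ∑ a with s a = w, h (p a) = (if κ w = w then 2 else 1) * ∑ b with r b = q w, h b := by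
  -- The total over all lifts of the edges at `q w`; it is then distributed among the points `w` and
  -- `κ w` above `q w`.
  have key := Finset.sum_comp_of_free_involution free hp surj
    fun b => if r b = q w then h b else 0
  rw [← Finset.sum_filter, ← Finset.sum_filter] at key
  have hfil : ∀ a, r (p a) = q w ↔ s a = w ∨ s a = κ w := fun a => by
    rw [← hr, eq_comm, hq]
  simp only [hfil] at key
  split_ifs with hw
  · simpa only [hw, or_self] using key
  · rw [Finset.filter_or, Finset.sum_union] at key
    -- When `w` and `κ w` differ, the involution exchanges their two fibers, so each carries half of
    -- the total.
    · have : ∑ a with s a = κ w, h (p a) = ∑ a with s a = w, h (p a) := by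
        refine Finset.sum_nbij' ι ι ?_ ?_ ?_ ?_ ?_
        · intro a ha
          simp only [Finset.mem_filter, Finset.mem_univ, true_and] at ha ⊢
          rw [hs, ha, invol']
        · intro a ha
          simp only [Finset.mem_filter, Finset.mem_univ, true_and] at ha ⊢
          rw [hs, ha]
        · exact fun a _ => invol a
        · exact fun a _ => invol a
        · exact fun a _ => congrArg h ((hp _ _).2 (Or.inr rfl))
      rw [this, ← two_mul] at key
      rw [one_mul]
      exact Nat.eq_of_mul_eq_mul_left two_pos key
    · rw [Finset.disjoint_left]
      intro a ha ha'
      simp only [Finset.mem_filter, Finset.mem_univ, true_and] at ha ha'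
      exact hw (ha'.symm.trans ha)

open Classical in
theorem MetricGraph.valency_eq_sum (Γ : MetricGraph) (v : Γ.Vert) :
    Γ.valency v = ∑ e with Γ.src e = v, 1 + ∑ e with Γ.tgt e = v, 1 := by
  simp only [MetricGraph.valency, Nat.card_eq_fintype_card, Fintype.card_subtype,
    Finset.card_eq_sum_ones]

open Classical in
/-- Every vertex of a tropical cover with valency two has one incoming and one outgoing edge. -/
theorem TropicalCover.card_src_eq_one {E : TropicalEllipticCurve} (C : TropicalCover E)
    {v : C.Vert} (hv : C.valency v = 2) :
    (Finset.univ.filter fun e => C.src e = v).card = 1 ∧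
      (Finset.univ.filter fun e => C.tgt e = v).card = 1 := by
  rw [MetricGraph.valency_eq_sum, ← Finset.card_eq_sum_ones, ← Finset.card_eq_sum_ones] at hv
  have hb := C.balanced v
  have pos : ∀ s : Finset C.Edge, s.Nonempty → 0 < ∑ e ∈ s, C.weight e := fun s hs =>
    Finset.sum_pos (fun e _ => C.weight_pos e) hs
  -- Weights are positive, so balancing forbids a vertex with edges on one side only; two edge ends
  -- must split as one and one.
  have h1 : (Finset.univ.filter fun e => C.src e = v).card ≠ 0 := by
    intro h0
    rw [h0, zero_add] at hv
    have := pos _ (Finset.card_pos.1 (hv ▸ two_pos))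
    rw [hb, Finset.card_eq_zero.1 h0] at this
    simp at this
  have h2 : (Finset.univ.filter fun e => C.tgt e = v).card ≠ 0 := by
    intro h0
    rw [h0, add_zero] at hv
    have := pos _ (Finset.card_pos.1 (hv ▸ two_pos))
    rw [← hb, Finset.card_eq_zero.1 h0] at this
    simp at this
  omega

/-! ### Automorphism counts, ramified vertices and the local conditions on a quotient -/

namespace TropicalCover

variable {E : TropicalEllipticCurve} {B : Finset (AddCircle E.len)}

instance (C D : TropicalCover E) : Finite (Iso C D) :=
  Finite.of_injective (fun f => (f.vert, f.edge)) fun f g h => by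
    rw [Prod.mk.injEq] at h
    exact Iso.ext h.1 h.2

theorem Iso.card_eq_autCard {C D : TropicalCover E} (f : Iso C D) :
    Nat.card (Iso C D) = D.autCard := by
  refine Nat.card_congr
    { toFun := fun g => f.symm.trans g
      invFun := fun g => f.trans g
      left_inv := fun g => ?_
      right_inv := fun g => ?_ }
  · ext x
    · change g.vert (f.vert.symm (f.vert x)) = g.vert x
      simp
    · change g.edge (f.edge.symm (f.edge x)) = g.edge x
      simp
  · ext x
    · change g.vert (f.vert (f.vert.symm x)) = g.vert x
      simp
    · change g.edge (f.edge (f.edge.symm x)) = g.edge x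
      simp

theorem autCard_pos (C : TropicalCover E) : 0 < C.autCard :=
  haveI : Nonempty (Iso C C) := ⟨Iso.refl C⟩
  Nat.card_pos

/-- The vertices of the quotient over which a twisted cover has a fixed vertex. -/
def Ramified (C : TropicalCover E) (B : Finset (AddCircle E.len)) (v : C.Vert) : Prop :=
  C.valency v = 2 ∧ C.proj v ∈ B

/-- The number of vertices that are not ramified. -/
noncomputable def freeCard (C : TropicalCover E)
    (B : Finset (AddCircle E.len)) : ℕ := Nat.card {v // ¬ C.Ramified B v}

/-- The local conditions satisfied by quotients of twisted tropical covers. -/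
structure IsTwistedQuotient (C : TropicalCover E) (B : Finset (AddCircle E.len)) : Prop where
  branch_mem : B ⊆ E.verts
  exists_proj : ∀ p ∈ B, ∃ v, C.proj v = p
  proj_inj : ∀ v w, C.proj v ∈ B → C.proj v = C.proj w → v = w
  branch : ∀ v, C.proj v ∈ B → C.valency v = 2 ∨ C.valency v = 3
  unbranched : ∀ v, C.proj v ∉ B → C.valency v = 2

end TropicalCover

/-! ### The projection from a twisted cover to its quotient -/

namespace TwistedTropicalCover

variable {E : TropicalEllipticCurve} {B : Finset (AddCircle E.len)} {C : TropicalCover E}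

/-- The vertex of `C` under a vertex of `P`, where `C` is identified with the quotient of `P`. -/
def vertMap {P : TwistedTropicalCover E B} (φ : TropicalCover.Iso P.quotient C) (w : P.Vert) :
    C.Vert := φ.vert (Quotient.mk P.vertSetoid w)

/-- The edge of `C` under an edge of `P`, where `C` is identified with the quotient of `P`. -/
def edgeMap {P : TwistedTropicalCover E B} (φ : TropicalCover.Iso P.quotient C) (e : P.Edge) :
    C.Edge := φ.edge (Quotient.mk P.edgeSetoid e)

section

variable {P : TwistedTropicalCover E B} (φ : TropicalCover.Iso P.quotient C)

theorem vertMap_eq_iff (w w' : P.Vert) :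
    vertMap φ w = vertMap φ w' ↔ w' = w ∨ w' = P.ι.vert w :=
  φ.vert.injective.eq_iff.trans Quotient.eq

theorem edgeMap_eq_iff (e e' : P.Edge) :
    edgeMap φ e = edgeMap φ e' ↔ e' = e ∨ e' = P.ι.edge e :=
  φ.edge.injective.eq_iff.trans Quotient.eq

theorem vertMap_surjective : Function.Surjective (vertMap φ) :=
  φ.vert.surjective.comp Quotient.mk_surjective

theorem edgeMap_surjective : Function.Surjective (edgeMap φ) :=
  φ.edge.surjective.comp Quotient.mk_surjective

theorem vertMap_ι (w : P.Vert) : vertMap φ (P.ι.vert w) = vertMap φ w :=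
  ((vertMap_eq_iff φ _ _).2 (Or.inr rfl)).symm

theorem edgeMap_ι (e : P.Edge) : edgeMap φ (P.ι.edge e) = edgeMap φ e :=
  ((edgeMap_eq_iff φ _ _).2 (Or.inr rfl)).symm

theorem vertMap_src (e : P.Edge) : vertMap φ (P.src e) = C.src (edgeMap φ e) :=
  (φ.src_edge (Quotient.mk P.edgeSetoid e)).symm

theorem vertMap_tgt (e : P.Edge) : vertMap φ (P.tgt e) = C.tgt (edgeMap φ e) :=
  (φ.tgt_edge (Quotient.mk P.edgeSetoid e)).symm

theorem length_edgeMap (e : P.Edge) : C.length (edgeMap φ e) = P.length e :=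
  φ.length_edge (Quotient.mk P.edgeSetoid e)

theorem weight_edgeMap (e : P.Edge) : C.weight (edgeMap φ e) = P.weight e :=
  φ.weight_edge (Quotient.mk P.edgeSetoid e)

theorem proj_vertMap (w : P.Vert) : C.proj (vertMap φ w) = P.proj w :=
  φ.proj_vert (Quotient.mk P.vertSetoid w)

-- Each edge end below has two lifts, as the involution is free on edges. They meet at a fixed
-- vertex and are shared equally between two exchanged vertices.
open Classical in
theorem valency_eq (w : P.Vert) :
    P.valency w = (if P.ι.vert w = w then 2 else 1) * C.valency (vertMap φ w) := by
  rw [MetricGraph.valency_eq_sum, MetricGraph.valency_eq_sum, mul_add]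
  congr 1
  · exact Finset.sum_fiber_of_involution P.ι_edge_ι_edge P.ι_vert_ι_vert P.ι_edge_ne
      (edgeMap_eq_iff φ) (edgeMap_surjective φ) (vertMap_eq_iff φ) (fun e => P.ι.src_edge e)
      (vertMap_src φ) (fun _ => 1) w
  · exact Finset.sum_fiber_of_involution P.ι_edge_ι_edge P.ι_vert_ι_vert P.ι_edge_ne
      (edgeMap_eq_iff φ) (edgeMap_surjective φ) (vertMap_eq_iff φ) (fun e => P.ι.tgt_edge e)
      (vertMap_tgt φ) (fun _ => 1) w

/-- A fixed vertex is 4-valent, so its image is 2-valent, and it lies over `B` because the other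
vertices are 2-valent. A vertex that is not fixed keeps its valency, and over `B` this would have to
be 3 or 4. The fixed locus can thus be read off from `C` alone. -/
theorem ι_vert_eq_iff_ramified (w : P.Vert) :
    P.ι.vert w = w ↔ C.Ramified B (vertMap φ w) := by
  have h := valency_eq φ w
  rw [TropicalCover.Ramified, proj_vertMap]
  constructor
  · intro hw
    have h4 := (P.ι_vert_eq_iff w).1 hw
    rw [if_pos hw] at h
    refine ⟨by omega, by_contra fun hB => ?_⟩
    have := P.unbranched w hB
    omega
  · rintro ⟨h2, hB⟩
    by_contra hw
    rw [if_neg hw, h2] at h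
    rcases P.branch _ hB with ⟨-, h'⟩ | ⟨-, h'⟩ <;> have := h' w rfl <;> omega

/-- The quotient of a twisted tropical cover satisfies the local conditions. -/
theorem isTwistedQuotient {P : TwistedTropicalCover E B} (φ : TropicalCover.Iso P.quotient C) :
    C.IsTwistedQuotient B where
  branch_mem := P.branch_mem
  exists_proj p hp := by
    have : Nonempty {v // P.proj v = p} := by
      rcases P.branch p hp with ⟨h, -⟩ | ⟨h, -⟩ <;>
        exact (Nat.card_pos_iff.1 (by omega)).1
    obtain ⟨w, hw⟩ := this
    exact ⟨vertMap φ w, (proj_vertMap φ w).trans hw⟩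
  proj_inj v v' hv h := by
    obtain ⟨w, rfl⟩ := vertMap_surjective φ v
    obtain ⟨w', rfl⟩ := vertMap_surjective φ v'
    rw [proj_vertMap] at hv h
    rw [proj_vertMap] at h
    rw [vertMap_eq_iff]
    rcases P.branch _ hv with ⟨hc, h3⟩ | ⟨hc, -⟩
    -- Otherwise `w`, its distinct image under the involution, and `w'` would be three vertices over
    -- a point that has only two.
    · by_contra! hne
      have hfix : P.ι.vert w ≠ w := fun hw => by
        have := (P.ι_vert_eq_iff w).1 hw
        have := h3 w rfl
        omega
      obtain ⟨x, y, -, hxy⟩ := Nat.card_eq_two_iff.1 hc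
      have all : ∀ z : {u // P.proj u = P.proj w}, z = x ∨ z = y := fun z => by
        have : z ∈ ({x, y} : Set _) := hxy ▸ Set.mem_univ z
        simpa using this
      have a1 := all ⟨w, rfl⟩
      have a2 := all ⟨P.ι.vert w, P.ι.proj_vert w⟩
      have a3 := all ⟨w', h.symm⟩
      grind
    · obtain ⟨hs, -⟩ := Nat.card_eq_one_iff_unique.1 hc
      exact Or.inl (congrArg Subtype.val
        (Subsingleton.elim (⟨w', h.symm⟩ : {u // P.proj u = P.proj w}) ⟨w, rfl⟩))
  branch v hv := by
    obtain ⟨w, rfl⟩ := vertMap_surjective φ v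
    rw [proj_vertMap] at hv
    have h := valency_eq φ w
    have hf := P.ι_vert_eq_iff w
    rcases P.branch _ hv with ⟨-, h'⟩ | ⟨-, h'⟩ <;> have := h' w rfl
    · rw [if_neg (by rw [hf]; omega)] at h
      omega
    · rw [if_pos (hf.2 this)] at h
      omega
  unbranched v hv := by
    obtain ⟨w, rfl⟩ := vertMap_surjective φ v
    rw [proj_vertMap] at hv
    have h := valency_eq φ w
    have := P.unbranched w hv
    rw [if_neg (by rw [P.ι_vert_eq_iff w]; omega)] at h
    omega

end

/-- A map to `C` whose fibers are the orbits of the involution identifies the quotient with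
`C`. -/
noncomputable def quotientIso (P : TwistedTropicalCover E B) {qV : P.Vert → C.Vert}
    {qE : P.Edge → C.Edge} (hV : ∀ w w', qV w = qV w' ↔ w' = w ∨ w' = P.ι.vert w)
    (hE : ∀ e e', qE e = qE e' ↔ e' = e ∨ e' = P.ι.edge e) (sV : Function.Surjective qV)
    (sE : Function.Surjective qE) (hsrc : ∀ e, C.src (qE e) = qV (P.src e))
    (htgt : ∀ e, C.tgt (qE e) = qV (P.tgt e)) (hlen : ∀ e, C.length (qE e) = P.length e)
    (hwt : ∀ e, C.weight (qE e) = P.weight e) (hproj : ∀ w, C.proj (qV w) = P.proj w) :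
    TropicalCover.Iso P.quotient C where
  vert := Equiv.ofBijective
    (Quotient.lift (s := P.vertSetoid) qV fun w w' h => (hV w w').2 h) (by
      constructor
      · rintro ⟨w⟩ ⟨w'⟩ h
        exact Quotient.sound ((hV w w').1 h)
      · intro v
        obtain ⟨w, rfl⟩ := sV v
        exact ⟨Quotient.mk _ w, rfl⟩)
  edge := Equiv.ofBijective
    (Quotient.lift (s := P.edgeSetoid) qE fun e e' h => (hE e e').2 h) (by
      constructor
      · rintro ⟨w⟩ ⟨w'⟩ h
        exact Quotient.sound ((hE w w').1 h)
      · intro v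
        obtain ⟨w, rfl⟩ := sE v
        exact ⟨Quotient.mk _ w, rfl⟩)
  src_edge := by
    rintro ⟨e⟩
    exact hsrc e
  tgt_edge := by
    rintro ⟨e⟩
    exact htgt e
  length_edge := by
    rintro ⟨e⟩
    exact hlen e
  weight_edge := by
    rintro ⟨e⟩
    exact hwt e
  proj_vert := by
    rintro ⟨w⟩
    exact hproj w

instance (P R : TwistedTropicalCover E B) : Finite (Iso P R) :=
  Finite.of_injective (fun f => (f.vert, f.edge)) fun f g h => by
    rw [Prod.mk.injEq] at h
    exact Iso.ext h.1 h.2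

theorem Iso.card_eq_autCard {P R : TwistedTropicalCover E B} (f : Iso P R) :
    Nat.card (Iso P R) = R.autCard := by
  refine Nat.card_congr
    { toFun := fun g => f.symm.trans g
      invFun := fun g => f.trans g
      left_inv := fun g => ?_
      right_inv := fun g => ?_ }
  · ext x
    · change g.vert (f.vert.symm (f.vert x)) = g.vert x
      simp
    · change g.edge (f.edge.symm (f.edge x)) = g.edge x
      simp
  · ext x
    · change g.vert (f.vert (f.vert.symm x)) = g.vert x
      simp
    · change g.edge (f.edge (f.edge.symm x)) = g.edge x
      simp

theorem autCard_pos (P : TwistedTropicalCover E B) : 0 < P.autCard :=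
  haveI : Nonempty (Iso P P) := ⟨Iso.refl P⟩
  Nat.card_pos

theorem Iso.connected {P R : TwistedTropicalCover E B} (f : Iso P R) (h : P.Connected) :
    R.Connected := by
  refine ⟨h.1.map f.vert, fun v w => ?_⟩
  have key : ∀ a b, Relation.EqvGen (fun a b => ∃ e, P.src e = a ∧ P.tgt e = b) a b →
      Relation.EqvGen (fun a b => ∃ e, R.src e = a ∧ R.tgt e = b) (f.vert a) (f.vert b) := by
    intro a b hab
    induction hab with
    | rel a b hab =>
      obtain ⟨e, rfl, rfl⟩ := hab
      exact .rel _ _ ⟨f.edge e, f.src_edge e, f.tgt_edge e⟩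
    | refl a => exact .refl _
    | symm a b _ ih => exact .symm _ _ ih
    | trans a b c _ _ ih ih' => exact .trans _ _ _ ih ih'
  simpa using key _ _ (h.2 (f.vert.symm v) (f.vert.symm w))

end TwistedTropicalCover

/-! ### Sheets, gluings and the twisted covers they define -/

namespace TropicalCover

variable {E : TropicalEllipticCurve} {B : Finset (AddCircle E.len)}

open Classical in
/-- The coefficient of a vertex: zero at ramified vertices, one elsewhere. -/
noncomputable def coeff (C : TropicalCover E) (B : Finset (AddCircle E.len)) (v : C.Vert) :
    ZMod 2 := if C.Ramified B v then 0 else 1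

theorem coeff_eq_zero_iff (C : TropicalCover E) (v : C.Vert) :
    C.coeff B v = 0 ↔ C.Ramified B v := by
  rw [coeff]
  split_ifs with h <;> simp [h]

/-- Idempotence lets the sheets be treated as the fixed subgroup of multiplication by the
coefficient, and keeps `Sheet.add` inside it, without a case split on ramification. -/
theorem coeff_mul_coeff (C : TropicalCover E) (v : C.Vert) :
    C.coeff B v * C.coeff B v = C.coeff B v := by
  rw [coeff]
  split_ifs <;> rfl

/-- The sheets over a vertex: one over a ramified vertex, two over the others. -/
def Sheet (C : TropicalCover E) (B : Finset (AddCircle E.len)) (v : C.Vert) : Type :=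
  {z : ZMod 2 // C.coeff B v * z = z}

noncomputable instance (C : TropicalCover E) (v : C.Vert) : Fintype (C.Sheet B v) :=
  inferInstanceAs (Fintype {z : ZMod 2 // C.coeff B v * z = z})

theorem Sheet.ext {C : TropicalCover E} {v : C.Vert} {z z' : C.Sheet B v} (h : z.1 = z'.1) :
    z = z' := Subtype.ext h

theorem Sheet.ext_iff {C : TropicalCover E} {v : C.Vert} {z z' : C.Sheet B v} :
    z = z' ↔ z.1 = z'.1 := Subtype.ext_iff

/-- Translation of sheets. -/
noncomputable def Sheet.add {C : TropicalCover E} {v : C.Vert} (z : C.Sheet B v) (i : ZMod 2) :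
    C.Sheet B v :=
  ⟨z.1 + C.coeff B v * i, by rw [mul_add, z.2, ← mul_assoc, coeff_mul_coeff]⟩

/-- The sheet of index zero. -/
def Sheet.zero (C : TropicalCover E) (B : Finset (AddCircle E.len)) (v : C.Vert) :
    C.Sheet B v := ⟨0, mul_zero _⟩

theorem Sheet.add_val {C : TropicalCover E} {v : C.Vert} (z : C.Sheet B v) (i : ZMod 2) :
    (z.add i).1 = z.1 + C.coeff B v * i := rfl

theorem Sheet.add_add {C : TropicalCover E} {v : C.Vert} (z : C.Sheet B v) (i j : ZMod 2) :
    (z.add i).add j = z.add (i + j) :=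
  Subtype.ext (by simp only [add_val]; ring)

theorem Sheet.add_zero {C : TropicalCover E} {v : C.Vert} (z : C.Sheet B v) :
    z.add 0 = z :=
  Subtype.ext (by simp only [add_val]; ring)

theorem Sheet.zero_add {C : TropicalCover E} {v : C.Vert} (z : C.Sheet B v) :
    (Sheet.zero C B v).add z.1 = z :=
  Subtype.ext (by rw [add_val, z.2]; exact _root_.zero_add _)

theorem Sheet.add_one_eq_iff {C : TropicalCover E} {v : C.Vert} (z : C.Sheet B v) :
    z.add 1 = z ↔ C.Ramified B v := by
  rw [← coeff_eq_zero_iff, Sheet.ext_iff, add_val, mul_one, add_eq_left]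

theorem Sheet.eq_or_eq {C : TropicalCover E} {v : C.Vert} (z z' : C.Sheet B v) :
    z' = z ∨ z' = z.add 1 := by
  rw [Sheet.ext_iff, Sheet.ext_iff, add_val]
  have key : ∀ c a b : ZMod 2, c * a = a → c * b = b → b = a ∨ b = a + c * 1 := by decide
  exact key _ _ _ z.2 z'.2

/-- The data that glue the sheets over the edges to the sheets over their ends. -/
@[ext]
structure Gluing (C : TropicalCover E) (B : Finset (AddCircle E.len)) where
  src : ∀ e, C.Sheet B (C.src e)
  tgt : ∀ e, C.Sheet B (C.tgt e)

namespace Gluing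

variable {C : TropicalCover E} (x : C.Gluing B)

/-- The vertices of the cover defined by a gluing. -/
abbrev Vert (C : TropicalCover E) (B : Finset (AddCircle E.len)) : Type := Σ v, C.Sheet B v

/-- The involution on vertices. -/
noncomputable def flipVert (w : Vert C B) : Vert C B := ⟨w.1, w.2.add 1⟩

/-- The involution on edges. -/
def flipEdge (a : C.Edge × ZMod 2) : C.Edge × ZMod 2 := (a.1, a.2 + 1)

theorem flipVert_flipVert (w : Vert C B) : flipVert (flipVert w) = w := by
  change (⟨w.1, (w.2.add 1).add 1⟩ : Vert C B) = w
  rw [Sheet.add_add, show (1 + 1 : ZMod 2) = 0 from rfl, Sheet.add_zero]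

theorem flipEdge_flipEdge (a : C.Edge × ZMod 2) : flipEdge (flipEdge a) = a := by
  change (a.1, a.2 + 1 + 1) = a
  rw [add_assoc, show (1 + 1 : ZMod 2) = 0 from rfl, add_zero]

theorem flipEdge_ne (a : C.Edge × ZMod 2) : flipEdge a ≠ a := fun h => by
  have := congrArg Prod.snd h
  simp [flipEdge] at this

theorem flipVert_eq_iff (w : Vert C B) : flipVert w = w ↔ C.Ramified B w.1 := by
  obtain ⟨v, z⟩ := w
  rw [← z.add_one_eq_iff]
  simp [flipVert]

theorem fst_vert_eq_iff (w w' : Vert C B) : w.1 = w'.1 ↔ w' = w ∨ w' = flipVert w := by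
  constructor
  · obtain ⟨v, z⟩ := w
    obtain ⟨v', z'⟩ := w'
    intro h
    change v = v' at h
    subst h
    rcases z.eq_or_eq z' with rfl | rfl
    · exact Or.inl rfl
    · exact Or.inr rfl
  · rintro (rfl | rfl) <;> rfl

theorem fst_edge_eq_iff (a b : C.Edge × ZMod 2) : a.1 = b.1 ↔ b = a ∨ b = flipEdge a := by
  constructor
  · obtain ⟨e, i⟩ := a
    obtain ⟨e', j⟩ := b
    intro h
    change e = e' at h
    subst h
    have : j = i ∨ j = i + 1 := by
      revert i j
      decide
    rcases this with rfl | rfl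
    · exact Or.inl rfl
    · exact Or.inr rfl
  · rintro (rfl | rfl) <;> rfl

theorem fst_vert_surjective : Function.Surjective (Sigma.fst : Vert C B → C.Vert) :=
  fun v => ⟨⟨v, Sheet.zero C B v⟩, rfl⟩

theorem fst_edge_surjective : Function.Surjective (Prod.fst : C.Edge × ZMod 2 → C.Edge) :=
  fun e => ⟨(e, 0), rfl⟩

/-- The metric graph defined by a gluing. -/
noncomputable def graph : MetricGraph where
  Vert := Vert C B
  Edge := C.Edge × ZMod 2
  src a := ⟨C.src a.1, (x.src a.1).add a.2⟩
  tgt a := ⟨C.tgt a.1, (x.tgt a.1).add a.2⟩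
  length a := C.length a.1
  length_pos a := C.length_pos a.1

open Classical in
theorem sum_src (h : C.Edge → ℕ) (w : Vert C B) :
    ∑ a with x.graph.src a = w, h (Prod.fst a) =
      (if C.Ramified B w.1 then 2 else 1) * ∑ e with C.src e = w.1, h e := by
  refine Eq.trans (Finset.sum_fiber_of_involution (α := C.Edge × ZMod 2) (γ := Vert C B)
    (s := x.graph.src)
    flipEdge_flipEdge flipVert_flipVert flipEdge_ne fst_edge_eq_iff
    fst_edge_surjective fst_vert_eq_iff
    (fun a => Sigma.ext rfl (heq_of_eq (Sheet.add_add _ _ _).symm)) (fun _ => rfl) h w)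
    (congrArg (· * _) (by congr 1; exact propext (flipVert_eq_iff w)))

open Classical in
theorem sum_tgt (h : C.Edge → ℕ) (w : Vert C B) :
    ∑ a with x.graph.tgt a = w, h (Prod.fst a) =
      (if C.Ramified B w.1 then 2 else 1) * ∑ e with C.tgt e = w.1, h e := by
  refine Eq.trans (Finset.sum_fiber_of_involution (α := C.Edge × ZMod 2) (γ := Vert C B)
    (s := x.graph.tgt)
    flipEdge_flipEdge flipVert_flipVert flipEdge_ne fst_edge_eq_iff
    fst_edge_surjective fst_vert_eq_iff
    (fun a => Sigma.ext rfl (heq_of_eq (Sheet.add_add _ _ _).symm)) (fun _ => rfl) h w)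
    (congrArg (· * _) (by congr 1; exact propext (flipVert_eq_iff w)))

open Classical in
theorem valency_graph (w : Vert C B) :
    x.graph.valency w = (if C.Ramified B w.1 then 2 else 1) * C.valency w.1 := by
  refine (x.graph.valency_eq_sum w).trans ?_
  rw [MetricGraph.valency_eq_sum, mul_add]
  exact congrArg₂ (· + ·) (x.sum_src (fun _ => 1) w) (x.sum_tgt (fun _ => 1) w)

/-- The cover of `E` defined by a gluing. -/
noncomputable def cover : TropicalCover E where
  toMetricGraph := x.graph
  weight a := C.weight (Prod.fst a)
  weight_pos a := C.weight_pos (Prod.fst a)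
  proj w := C.proj (Sigma.fst w)
  proj_mem w := C.proj_mem (Sigma.fst w)
  proj_tgt a := C.proj_tgt (Prod.fst a)
  balanced w := by
    have h1 := x.sum_src C.weight w
    have h2 := x.sum_tgt C.weight w
    rw [← C.balanced, ← h2] at h1
    exact h1.symm
  surjective p := by
    obtain ⟨e, t, ht, hp⟩ := C.surjective p
    exact ⟨(e, 0), t, ht, hp⟩

/-- The involution of the cover defined by a gluing. -/
noncomputable def involution : Iso x.cover x.cover where
  vert := ⟨flipVert, flipVert, flipVert_flipVert, flipVert_flipVert⟩
  edge := ⟨flipEdge, flipEdge, flipEdge_flipEdge, flipEdge_flipEdge⟩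
  src_edge _ := Sigma.ext rfl (heq_of_eq (Sheet.add_add _ _ _).symm)
  tgt_edge _ := Sigma.ext rfl (heq_of_eq (Sheet.add_add _ _ _).symm)
  length_edge _ := rfl
  weight_edge _ := rfl
  proj_vert _ := rfl

/-- The valency 2 of a ramified vertex is doubled; elsewhere it stays 2 or 3. -/
theorem valency_eq_four_iff (hC : C.IsTwistedQuotient B) (w : Vert C B) :
    x.graph.valency w = 4 ↔ C.Ramified B w.1 := by
  rw [valency_graph]
  split_ifs with h
  · have := h.1
    simp only [h, iff_true]
    omega
  · simp only [h, iff_false]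
    by_cases hB : C.proj w.1 ∈ B
    · have := hC.branch _ hB
      omega
    · have := hC.unbranched _ hB
      omega

open Classical in
/-- The twisted tropical cover defined by a gluing. -/
noncomputable def twisted (hC : C.IsTwistedQuotient B) : TwistedTropicalCover E B where
  toTropicalCover := x.cover
  ι := x.involution
  ι_vert_ι_vert := flipVert_flipVert
  ι_edge_ι_edge := flipEdge_flipEdge
  branch_mem := hC.branch_mem
  branch p hp := by
    obtain ⟨v, rfl⟩ := hC.exists_proj p hp
    -- Over a branch point `C` has a single vertex, so the fiber over the point is the set of sheets
    -- over `v`.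
    have hfib : ∀ w : Vert C B, C.proj w.1 = C.proj v ↔ w.1 = v := fun w =>
      ⟨fun h => (hC.proj_inj _ _ hp h.symm).symm, fun h => congrArg _ h⟩
    have hcard : ∀ n, Nat.card {w : Vert C B // w.1 = v} = n →
      Nat.card {w // x.cover.proj w = C.proj v} = n := fun n hn =>
      (Nat.card_congr (Equiv.subtypeEquivRight hfib)).trans hn
    by_cases hv : C.Ramified B v
    · refine Or.inr ⟨hcard 1 ?_, fun w hw => ?_⟩
      · rw [Nat.card_eq_one_iff_unique]
        refine ⟨⟨fun w w' => Subtype.ext ?_⟩, ⟨⟨⟨v, Sheet.zero C B v⟩, rfl⟩⟩⟩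
        rcases (fst_vert_eq_iff _ _).1 (w'.2.trans w.2.symm) with h | h
        · exact h
        · rw [h, (flipVert_eq_iff _).2 (by rwa [w'.2])]
      · exact (x.valency_eq_four_iff hC w).2 (by rwa [(hfib w).1 hw])
    · refine Or.inl ⟨hcard 2 ?_, fun w hw => ?_⟩
      · rw [Nat.card_eq_two_iff]
        refine ⟨⟨⟨v, Sheet.zero C B v⟩, rfl⟩, ⟨flipVert ⟨v, Sheet.zero C B v⟩, rfl⟩, ?_, ?_⟩
        · intro h
          exact hv ((flipVert_eq_iff _).1 (congrArg Subtype.val h).symm)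
        · rw [Set.eq_univ_iff_forall]
          intro w
          rcases (fst_vert_eq_iff ⟨v, Sheet.zero C B v⟩ w.1).1 w.2.symm with h | h
          · exact Or.inl (Subtype.ext h)
          · exact Or.inr (Subtype.ext h)
      · rw [← (hfib w).1 hw] at hv hp
        refine (x.valency_graph w).trans ?_
        rw [if_neg hv]
        rcases hC.branch _ hp with h | h
        · exact absurd ⟨h, hp⟩ hv
        · rw [h]
  unbranched w hw := by
    refine (x.valency_graph w).trans ?_
    rw [if_neg (fun h => hw h.2), hC.unbranched _ hw]
  weight_eq w hw a b ha hb := by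
    have h2 := ((x.valency_eq_four_iff hC w).1 hw).1
    obtain ⟨h1, h2⟩ := C.card_src_eq_one h2
    obtain ⟨e, he⟩ := Finset.card_eq_one.1 h1
    obtain ⟨e', he'⟩ := Finset.card_eq_one.1 h2
    -- Below a 4-valent vertex there is one incoming edge `e'` and one outgoing edge `e`; balancing
    -- equates their weights, and all edges upstairs at `w` lie over these two.
    have hbal := C.balanced (Sigma.fst w)
    rw [he, he', Finset.sum_singleton, Finset.sum_singleton] at hbal
    have key : ∀ a : C.Edge × ZMod 2, x.graph.src a = w ∨ x.graph.tgt a = w →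
        C.weight a.1 = C.weight e := by
      rintro a (rfl | rfl)
      · have : a.1 ∈ ({e} : Finset C.Edge) := he ▸ Finset.mem_filter.2 ⟨Finset.mem_univ _, rfl⟩
        rw [Finset.mem_singleton.1 this]
      · have : a.1 ∈ ({e'} : Finset C.Edge) := he' ▸ Finset.mem_filter.2 ⟨Finset.mem_univ _, rfl⟩
        rw [Finset.mem_singleton.1 this, hbal]
    exact (key a ha).trans (key b hb).symm
  ι_vert_eq_iff w := (flipVert_eq_iff w).trans (x.valency_eq_four_iff hC w).symm
  ι_edge_ne := flipEdge_ne

/-- The quotient of the twisted cover defined by a gluing is the given cover. -/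
noncomputable def twistedQuotientIso (hC : C.IsTwistedQuotient B) :
    Iso (x.twisted hC).quotient C :=
  (x.twisted hC).quotientIso (qV := (Sigma.fst : Vert C B → C.Vert))
    (qE := (Prod.fst : C.Edge × ZMod 2 → C.Edge))
    fst_vert_eq_iff fst_edge_eq_iff fst_vert_surjective fst_edge_surjective
    (fun _ => rfl) (fun _ => rfl) (fun _ => rfl) (fun _ => rfl) (fun _ => rfl)

end Gluing

end TropicalCover

/-! ### Markings of a twisted cover and the weighted count of gluings -/

namespace TwistedTropicalCover

variable {E : TropicalEllipticCurve} {B : Finset (AddCircle E.len)} {C : TropicalCover E}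

/-- The action of `ZMod 2` on the vertices by the involution. -/
def flipVert (P : TwistedTropicalCover E B) (z : ZMod 2) (w : P.Vert) : P.Vert :=
  if z = 0 then w else P.ι.vert w

/-- The action of `ZMod 2` on the edges by the involution. -/
def flipEdge (P : TwistedTropicalCover E B) (z : ZMod 2) (e : P.Edge) : P.Edge :=
  if z = 0 then e else P.ι.edge e

section

variable (P : TwistedTropicalCover E B)

theorem flipVert_zero (w : P.Vert) : P.flipVert 0 w = w := rfl

theorem flipVert_one (w : P.Vert) : P.flipVert 1 w = P.ι.vert w := rfl

theorem flipVert_flipVert (z z' : ZMod 2) (w : P.Vert) :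
    P.flipVert z (P.flipVert z' w) = P.flipVert (z' + z) w := by
  fin_cases z <;> fin_cases z'
  · rfl
  · rfl
  · rfl
  · exact P.ι_vert_ι_vert w

theorem flipEdge_flipEdge (z z' : ZMod 2) (e : P.Edge) :
    P.flipEdge z (P.flipEdge z' e) = P.flipEdge (z' + z) e := by
  fin_cases z <;> fin_cases z'
  · rfl
  · rfl
  · rfl
  · exact P.ι_edge_ι_edge e

theorem src_flipEdge (z : ZMod 2) (e : P.Edge) :
    P.src (P.flipEdge z e) = P.flipVert z (P.src e) := by
  fin_cases z
  · rfl
  · exact P.ι.src_edge e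

theorem tgt_flipEdge (z : ZMod 2) (e : P.Edge) :
    P.tgt (P.flipEdge z e) = P.flipVert z (P.tgt e) := by
  fin_cases z
  · rfl
  · exact P.ι.tgt_edge e

theorem flipEdge_injective (e : P.Edge) : Function.Injective fun z => P.flipEdge z e := by
  intro z z' h
  fin_cases z <;> fin_cases z'
  · rfl
  · exact absurd h.symm (P.ι_edge_ne e)
  · exact absurd h (P.ι_edge_ne e)
  · rfl

end

section

variable {P : TwistedTropicalCover E B} (φ : TropicalCover.Iso P.quotient C)

theorem vertMap_flipVert (z : ZMod 2) (w : P.Vert) :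
    vertMap φ (P.flipVert z w) = vertMap φ w := by
  fin_cases z
  · rfl
  · exact vertMap_ι φ w

theorem edgeMap_flipEdge (z : ZMod 2) (e : P.Edge) :
    edgeMap φ (P.flipEdge z e) = edgeMap φ e := by
  fin_cases z
  · rfl
  · exact edgeMap_ι φ e

/-- Over a ramified vertex the involution fixes `w` anyway; elsewhere the coefficient is one. -/
theorem flipVert_coeff_mul {w : P.Vert} {v : C.Vert} (hw : vertMap φ w = v) (z : ZMod 2) :
    P.flipVert (C.coeff B v * z) w = P.flipVert z w := by
  subst hw
  fin_cases z
  · exact congrArg (P.flipVert · w) (mul_zero _)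
  · refine (congrArg (P.flipVert · w) (mul_one _)).trans ?_
    by_cases h : C.Ramified B (vertMap φ w)
    · rw [(C.coeff_eq_zero_iff _).2 h, flipVert_zero]
      exact ((ι_vert_eq_iff_ramified φ w).2 h).symm
    · rw [TropicalCover.coeff, if_neg h]
      rfl

/-- With `exists_sheet`, this makes the fiber of `vertMap` over `v` a torsor under the sheets.
Distinct sheets differ by one, which happens only over an unramified vertex, where the involution
moves `w`. -/
theorem sheet_eq_of_flipVert_eq {w : P.Vert} {v : C.Vert} (hw : vertMap φ w = v)
    {z z' : C.Sheet B v} (h : P.flipVert z.1 w = P.flipVert z'.1 w) : z = z' := by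
  subst hw
  by_contra hne
  have hz : z' = z.add 1 := (z.eq_or_eq z').resolve_left (Ne.symm hne)
  have hr : ¬ C.Ramified B (vertMap φ w) := fun hr =>
    hne ((z.add_one_eq_iff.2 hr).symm.trans hz.symm)
  rw [hz, TropicalCover.Sheet.add_val, ← flipVert_flipVert, flipVert_coeff_mul φ
    (vertMap_flipVert φ _ _), flipVert_one] at h
  rw [← vertMap_flipVert φ z.1, ← ι_vert_eq_iff_ramified] at hr
  exact hr h.symm

theorem exists_sheet {b w : P.Vert} {v : C.Vert} (hb : vertMap φ b = v) (hw : vertMap φ w = v) :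
    ∃ z : C.Sheet B v, P.flipVert z.1 b = w := by
  rcases (vertMap_eq_iff φ b w).1 (hb.trans hw.symm) with rfl | rfl
  · exact ⟨TropicalCover.Sheet.zero C B v, rfl⟩
  · refine ⟨(TropicalCover.Sheet.zero C B v).add 1, ?_⟩
    rw [TropicalCover.Sheet.add_val, ← flipVert_flipVert, flipVert_coeff_mul φ
      (vertMap_flipVert φ _ _ |>.trans hb)]
    rfl

theorem exists_flipEdge {b e : P.Edge} (h : edgeMap φ b = edgeMap φ e) :
    ∃ i, P.flipEdge i b = e := by
  rcases (edgeMap_eq_iff φ b e).1 h with rfl | rfl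
  · exact ⟨0, rfl⟩
  · exact ⟨1, rfl⟩

end

/-- An identification of the quotient of `P` with `C`, with a section of the vertices and a
section of the edges. -/
abbrev Marking (P : TwistedTropicalCover E B) (C : TropicalCover E) : Type :=
  Σ φ : TropicalCover.Iso P.quotient C,
    (∀ v, {w // vertMap φ w = v}) × (∀ e, {a // edgeMap φ a = e})

namespace Marking

variable {P : TwistedTropicalCover E B} (m : P.Marking C)

theorem vertMap_src_edge (e : C.Edge) : vertMap m.1 (P.src (m.2.2 e).1) = C.src e := by
  rw [vertMap_src, (m.2.2 e).2]

theorem vertMap_tgt_edge (e : C.Edge) : vertMap m.1 (P.tgt (m.2.2 e).1) = C.tgt e := by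
  rw [vertMap_tgt, (m.2.2 e).2]

/-- The gluing read off from a marking. -/
noncomputable def gluing : C.Gluing B where
  src e := (exists_sheet m.1 (m.2.1 (C.src e)).2 (m.vertMap_src_edge e)).choose
  tgt e := (exists_sheet m.1 (m.2.1 (C.tgt e)).2 (m.vertMap_tgt_edge e)).choose

theorem flipVert_gluing_src (e : C.Edge) :
    P.flipVert (m.gluing.src e).1 (m.2.1 (C.src e)).1 = P.src (m.2.2 e).1 :=
  (exists_sheet m.1 (m.2.1 (C.src e)).2 (m.vertMap_src_edge e)).choose_spec

theorem flipVert_gluing_tgt (e : C.Edge) :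
    P.flipVert (m.gluing.tgt e).1 (m.2.1 (C.tgt e)).1 = P.tgt (m.2.2 e).1 :=
  (exists_sheet m.1 (m.2.1 (C.tgt e)).2 (m.vertMap_tgt_edge e)).choose_spec

/-- The labelling of the vertices given by a marking. -/
def vertFun (w : TropicalCover.Gluing.Vert C B) : P.Vert := P.flipVert w.2.1 (m.2.1 w.1).1

/-- The labelling of the edges given by a marking. -/
def edgeFun (a : C.Edge × ZMod 2) : P.Edge := P.flipEdge a.2 (m.2.2 a.1).1

theorem vertMap_vertFun (w : TropicalCover.Gluing.Vert C B) :
    vertMap m.1 (m.vertFun w) = w.1 :=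
  (vertMap_flipVert _ _ _).trans (m.2.1 w.1).2

theorem edgeMap_edgeFun (a : C.Edge × ZMod 2) : edgeMap m.1 (m.edgeFun a) = a.1 :=
  (edgeMap_flipEdge _ _ _).trans (m.2.2 a.1).2

theorem flipVert_sheet_add {v : C.Vert} (z : C.Sheet B v) (i : ZMod 2) :
    P.flipVert (z.add i).1 (m.2.1 v).1 = P.flipVert i (P.flipVert z.1 (m.2.1 v).1) := by
  rw [TropicalCover.Sheet.add_val, ← flipVert_flipVert]
  exact flipVert_coeff_mul m.1 ((vertMap_flipVert _ _ _).trans (m.2.1 v).2) i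

theorem vertFun_bijective : Function.Bijective m.vertFun := by
  constructor
  · intro w w' h
    have h1 := congrArg (vertMap m.1) h
    rw [vertMap_vertFun, vertMap_vertFun] at h1
    obtain ⟨v, z⟩ := w
    obtain ⟨v', z'⟩ := w'
    change v = v' at h1
    subst h1
    exact congrArg _ (sheet_eq_of_flipVert_eq m.1 (m.2.1 v).2 h)
  · intro w
    obtain ⟨z, hz⟩ := exists_sheet m.1 (m.2.1 (vertMap m.1 w)).2 (rfl : vertMap m.1 w = _)
    exact ⟨⟨_, z⟩, hz⟩

theorem edgeFun_bijective : Function.Bijective m.edgeFun := by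
  constructor
  · intro a a' h
    have h1 := congrArg (edgeMap m.1) h
    rw [edgeMap_edgeFun, edgeMap_edgeFun] at h1
    obtain ⟨e, i⟩ := a
    obtain ⟨e', i'⟩ := a'
    change e = e' at h1
    subst h1
    exact congrArg _ (P.flipEdge_injective _ h)
  · intro e
    obtain ⟨i, hi⟩ := exists_flipEdge m.1 (m.2.2 (edgeMap m.1 e)).2
    exact ⟨⟨_, i⟩, hi⟩

/-- The isomorphism from the cover defined by a gluing that is given by a marking. -/
noncomputable def iso (hC : C.IsTwistedQuotient B) : Iso (m.gluing.twisted hC) P where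
  vert := Equiv.ofBijective m.vertFun m.vertFun_bijective
  edge := Equiv.ofBijective m.edgeFun m.edgeFun_bijective
  src_edge a := by
    refine (src_flipEdge _ _ _).trans ?_
    rw [← flipVert_gluing_src]
    exact (m.flipVert_sheet_add _ _).symm
  tgt_edge a := by
    refine (tgt_flipEdge _ _ _).trans ?_
    rw [← flipVert_gluing_tgt]
    exact (m.flipVert_sheet_add _ _).symm
  length_edge a := by
    refine (length_edgeMap m.1 _).symm.trans ?_
    exact congrArg C.length (m.edgeMap_edgeFun a)
  weight_edge a := by
    refine (weight_edgeMap m.1 _).symm.trans ?_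
    exact congrArg C.weight (m.edgeMap_edgeFun a)
  proj_vert w := by
    refine (proj_vertMap m.1 _).symm.trans ?_
    exact congrArg C.proj (m.vertMap_vertFun w)
  vert_ι w := m.flipVert_sheet_add w.2 1
  edge_ι a := (P.flipEdge_flipEdge 1 a.2 _).symm

theorem iso_injective (hC : C.IsTwistedQuotient B) :
    Function.Injective fun m : P.Marking C =>
      (⟨m.gluing, m.iso hC⟩ : Σ x : C.Gluing B, Iso (x.twisted hC) P) := by
  -- The vertex and edge types of the glued cover do not depend on the gluing, so the two
  -- isomorphisms can be compared pointwise although their types differ.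
  have key : ∀ (p q : Σ x : C.Gluing B, Iso (x.twisted hC) P), p = q →
      (∀ w : TropicalCover.Gluing.Vert C B, p.2.vert w = q.2.vert w) ∧
        ∀ a : C.Edge × ZMod 2, p.2.edge a = q.2.edge a := by
    rintro p q rfl
    exact ⟨fun _ => rfl, fun _ => rfl⟩
  intro m n h
  obtain ⟨hv, he⟩ := key _ _ h
  -- The sections are the images of the zero sheets. The identification of the quotient is then
  -- recovered because the labellings are onto.
  have hσ : ∀ v, (m.2.1 v).1 = (n.2.1 v).1 := fun v => hv ⟨v, TropicalCover.Sheet.zero C B v⟩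
  have hτ : ∀ e, (m.2.2 e).1 = (n.2.2 e).1 := fun e => he (e, 0)
  have hφ : m.1 = n.1 := by
    ext x
    · obtain ⟨w, rfl⟩ := Quotient.exists_rep x
      obtain ⟨u, rfl⟩ := m.vertFun_bijective.2 w
      have h1 := m.vertMap_vertFun u
      have h2 := n.vertMap_vertFun u
      rw [show n.vertFun u = m.vertFun u from (hv u).symm] at h2
      exact h1.trans h2.symm
    · obtain ⟨e, rfl⟩ := Quotient.exists_rep x
      obtain ⟨u, rfl⟩ := m.edgeFun_bijective.2 e
      have h1 := m.edgeMap_edgeFun u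
      have h2 := n.edgeMap_edgeFun u
      rw [show n.edgeFun u = m.edgeFun u from (he u).symm] at h2
      exact h1.trans h2.symm
  obtain ⟨φ, σ, τ⟩ := m
  obtain ⟨φ', σ', τ'⟩ := n
  change φ = φ' at hφ
  subst hφ
  congr 2
  · exact funext fun v => Subtype.ext (hσ v)
  · exact funext fun e => Subtype.ext (hτ e)

end Marking

section

variable {P : TwistedTropicalCover E B} {hC : C.IsTwistedQuotient B} {x : C.Gluing B}
  (f : Iso (x.twisted hC) P)

theorem Iso.vert_sheet_add {v : C.Vert} (z : C.Sheet B v) (i : ZMod 2) :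
    f.vert (⟨v, z.add i⟩ : TropicalCover.Gluing.Vert C B) =
      P.flipVert i (f.vert (⟨v, z⟩ : TropicalCover.Gluing.Vert C B)) := by
  fin_cases i
  · exact congrArg (fun y => f.vert (⟨v, y⟩ : TropicalCover.Gluing.Vert C B)) z.add_zero
  · exact f.vert_ι (⟨v, z⟩ : TropicalCover.Gluing.Vert C B)

theorem Iso.vert_sheet {v : C.Vert} (z : C.Sheet B v) :
    P.flipVert z.1 (f.vert (⟨v, .zero C B v⟩ : TropicalCover.Gluing.Vert C B)) =
      f.vert (⟨v, z⟩ : TropicalCover.Gluing.Vert C B) := by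
  rw [← Iso.vert_sheet_add, TropicalCover.Sheet.zero_add]

theorem Iso.edge_sheet (e : C.Edge) (i : ZMod 2) :
    P.flipEdge i (f.edge ((e, 0) : C.Edge × ZMod 2)) = f.edge ((e, i) : C.Edge × ZMod 2) := by
  fin_cases i
  · rfl
  · exact (f.edge_ι _).symm

/-- The identification of the quotient induced by an isomorphism from the cover defined by a
gluing. -/
noncomputable def Iso.quotientIso : TropicalCover.Iso P.quotient C :=
  P.quotientIso (qV := fun w => Sigma.fst (f.vert.symm w))
    (qE := fun e => Prod.fst (f.edge.symm e))
    (fun w w' => by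
      refine (TropicalCover.Gluing.fst_vert_eq_iff (f.vert.symm w) (f.vert.symm w')).trans
        (or_congr f.vert.symm.injective.eq_iff ?_)
      exact (Equiv.symm_apply_eq _).trans (Eq.congr_right <|
        (f.vert_ι _).trans (congrArg P.ι.vert (f.vert.apply_symm_apply w))))
    (fun e e' => by
      refine (TropicalCover.Gluing.fst_edge_eq_iff (f.edge.symm e) (f.edge.symm e')).trans
        (or_congr f.edge.symm.injective.eq_iff ?_)
      exact (Equiv.symm_apply_eq _).trans (Eq.congr_right <|
        (f.edge_ι _).trans (congrArg P.ι.edge (f.edge.apply_symm_apply e))))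
    (TropicalCover.Gluing.fst_vert_surjective.comp f.vert.symm.surjective)
    (TropicalCover.Gluing.fst_edge_surjective.comp f.edge.symm.surjective)
    (fun e => congrArg Sigma.fst (f.toIso.symm.src_edge e))
    (fun e => congrArg Sigma.fst (f.toIso.symm.tgt_edge e))
    f.toIso.symm.length_edge f.toIso.symm.weight_edge f.toIso.symm.proj_vert

theorem Iso.vertMap_quotientIso (w : TropicalCover.Gluing.Vert C B) :
    vertMap f.quotientIso (f.vert w) = w.1 :=
  congrArg Sigma.fst (f.vert.symm_apply_apply w)

theorem Iso.edgeMap_quotientIso (a : C.Edge × ZMod 2) :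
    edgeMap f.quotientIso (f.edge a) = a.1 :=
  congrArg Prod.fst (f.edge.symm_apply_apply a)

/-- The marking given by an isomorphism from the cover defined by a gluing. -/
noncomputable def Iso.marking : P.Marking C :=
  ⟨f.quotientIso,
    fun v => ⟨f.vert (⟨v, .zero C B v⟩ : TropicalCover.Gluing.Vert C B),
      f.vertMap_quotientIso _⟩,
    fun e => ⟨f.edge ((e, 0) : C.Edge × ZMod 2), f.edgeMap_quotientIso _⟩⟩

/-- Both gluings record the ends of the image under `f` of sheet zero of each edge, and a sheet is
determined by the vertex it labels. -/
theorem Iso.gluing_marking : f.marking.gluing = x := by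
  ext e
  · refine sheet_eq_of_flipVert_eq f.marking.1 (f.marking.2.1 _).2 ?_
    rw [Marking.flipVert_gluing_src]
    refine ((f.src_edge _).trans ?_).trans (f.vert_sheet (x.src e)).symm
    exact congrArg (fun y => f.vert (⟨C.src e, y⟩ : TropicalCover.Gluing.Vert C B))
      (x.src e).add_zero
  · refine sheet_eq_of_flipVert_eq f.marking.1 (f.marking.2.1 _).2 ?_
    rw [Marking.flipVert_gluing_tgt]
    refine ((f.tgt_edge _).trans ?_).trans (f.vert_sheet (x.tgt e)).symm
    exact congrArg (fun y => f.vert (⟨C.tgt e, y⟩ : TropicalCover.Gluing.Vert C B))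
      (x.tgt e).add_zero

end

/-- Transporting the zero sheets along `f` gives a preimage; an equivariant map is determined by its
values on zero sheets. -/
theorem Marking.iso_surjective (P : TwistedTropicalCover E B) (hC : C.IsTwistedQuotient B) :
    Function.Surjective fun m : P.Marking C =>
      (⟨m.gluing, m.iso hC⟩ : Σ x : C.Gluing B, Iso (x.twisted hC) P) := by
  have key : ∀ (p q : Σ x : C.Gluing B, Iso (x.twisted hC) P), p.1 = q.1 →
      (∀ w : TropicalCover.Gluing.Vert C B, p.2.vert w = q.2.vert w) →
        (∀ a : C.Edge × ZMod 2, p.2.edge a = q.2.edge a) → p = q := by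
    rintro ⟨x, f⟩ ⟨y, g⟩ h hv he
    change x = y at h
    subst h
    congr 1
    ext w
    · exact hv w
    · exact he w
  rintro ⟨x, f⟩
  exact ⟨f.marking, key _ _ f.gluing_marking (fun w => f.vert_sheet w.2)
    fun a => f.edge_sheet a.1 a.2⟩

/-- Markings of `P` amount to isomorphisms from covers defined by gluings. -/
theorem card_marking (P : TwistedTropicalCover E B) (hC : C.IsTwistedQuotient B) :
    Nat.card (P.Marking C) = Nat.card (Σ x : C.Gluing B, Iso (x.twisted hC) P) :=
  Nat.card_congr (Equiv.ofBijective _ ⟨Marking.iso_injective hC, Marking.iso_surjective P hC⟩)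

theorem card_vertMap_fiber {P : TwistedTropicalCover E B} (φ : TropicalCover.Iso P.quotient C)
    (v : C.Vert) [Decidable (C.Ramified B v)] :
    Nat.card {w // vertMap φ w = v} = if C.Ramified B v then 1 else 2 := by
  obtain ⟨w, rfl⟩ := vertMap_surjective φ v
  have hfix := ι_vert_eq_iff_ramified φ w
  have hfib : ∀ u, vertMap φ u = vertMap φ w ↔ u = w ∨ u = P.ι.vert w := fun u => by
    rw [eq_comm, vertMap_eq_iff]
  split_ifs with h
  · rw [Nat.card_eq_one_iff_unique]
    refine ⟨⟨fun a b => Subtype.ext ?_⟩, ⟨⟨w, rfl⟩⟩⟩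
    have ha := (hfib _).1 a.2
    have hb := (hfib _).1 b.2
    rw [hfix.2 h, or_self] at ha hb
    exact ha.trans hb.symm
  · rw [Nat.card_eq_two_iff]
    refine ⟨⟨w, rfl⟩, ⟨P.ι.vert w, vertMap_ι φ w⟩, ?_, Set.eq_univ_iff_forall.2 fun a => ?_⟩
    · exact fun hw => h (hfix.1 (congrArg Subtype.val hw).symm)
    · exact ((hfib _).1 a.2).imp Subtype.ext Subtype.ext

theorem card_edgeMap_fiber {P : TwistedTropicalCover E B} (φ : TropicalCover.Iso P.quotient C)
    (e : C.Edge) : Nat.card {a // edgeMap φ a = e} = 2 := by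
  obtain ⟨a, rfl⟩ := edgeMap_surjective φ e
  rw [Nat.card_eq_two_iff]
  refine ⟨⟨a, rfl⟩, ⟨P.ι.edge a, edgeMap_ι φ a⟩, ?_, Set.eq_univ_iff_forall.2 fun b => ?_⟩
  · exact fun h => P.ι_edge_ne a (congrArg Subtype.val h).symm
  · exact ((edgeMap_eq_iff φ _ _).1 b.2.symm).imp Subtype.ext Subtype.ext

-- Identifications of the quotient with `C` form a torsor under the automorphisms of `C`; for each
-- of them, every unramified vertex and every edge offers two choices of zero sheet.
open Classical in
theorem card_marking_eq {P : TwistedTropicalCover E B} (φ : TropicalCover.Iso P.quotient C) :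
    Nat.card (P.Marking C) =
      C.autCard * (2 ^ C.freeCard B * 2 ^ Fintype.card C.Edge) := by
  have := Fintype.ofFinite (TropicalCover.Iso P.quotient C)
  rw [Nat.card_sigma, Finset.sum_congr rfl (g := fun _ =>
    2 ^ C.freeCard B * 2 ^ Fintype.card C.Edge), Finset.sum_const, smul_eq_mul,
    Finset.card_univ, ← Nat.card_eq_fintype_card, φ.card_eq_autCard]
  intro ψ _
  rw [Nat.card_prod, Nat.card_pi, Nat.card_pi]
  simp only [card_vertMap_fiber, card_edgeMap_fiber]
  congr 1
  · rw [Finset.prod_ite, Finset.prod_const_one, one_mul, Finset.prod_const,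
      TropicalCover.freeCard, Nat.card_eq_fintype_card, Fintype.card_subtype]
  · rw [Finset.prod_const, Finset.card_univ]

open Classical in
instance : Finite (C.Gluing B) :=
  Finite.of_injective (fun x => (x.src, x.tgt)) fun x y h => by
    rw [Prod.mk.injEq] at h
    exact TropicalCover.Gluing.ext h.1 h.2

/-- The number of gluings defining a cover isomorphic to a given one, weighted by its
automorphisms. -/
theorem card_gluing_mul_autCard {P : TwistedTropicalCover E B} (hC : C.IsTwistedQuotient B)
    (φ : TropicalCover.Iso P.quotient C) :
    Nat.card {x : C.Gluing B // Nonempty (Iso (x.twisted hC) P)} * P.autCard =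
      C.autCard * (2 ^ C.freeCard B * 2 ^ Fintype.card C.Edge) := by
  classical
  have := Fintype.ofFinite (C.Gluing B)
  rw [← card_marking_eq φ, P.card_marking hC, Nat.card_sigma, Nat.card_eq_fintype_card,
    Fintype.card_subtype, ← smul_eq_mul, ← Finset.sum_const, Finset.sum_filter]
  refine Finset.sum_congr rfl fun x _ => ?_
  split_ifs with h
  -- A nonempty set of isomorphisms is a torsor under the automorphisms of `P`; the other gluings
  -- contribute nothing.
  · exact h.some.card_eq_autCard.symm
  · rw [not_nonempty_iff] at h
    exact Nat.card_of_isEmpty.symm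

/-- Every twisted cover with quotient `C` is defined by a gluing. -/
theorem exists_gluing {P : TwistedTropicalCover E B} (hC : C.IsTwistedQuotient B)
    (φ : TropicalCover.Iso P.quotient C) :
    ∃ x : C.Gluing B, Nonempty (Iso (x.twisted hC) P) := by
  have h := card_gluing_mul_autCard hC φ
  -- Existence is read off from the count, which is nonzero.
  have hpos : 0 < C.autCard * (2 ^ C.freeCard B * 2 ^ Fintype.card C.Edge) :=
    Nat.mul_pos C.autCard_pos (by positivity)
  rw [← h] at hpos
  obtain ⟨⟨x⟩, -⟩ := Nat.card_pos_iff.1 (Nat.pos_of_mul_pos_right hpos)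
  exact ⟨x.1, x.2⟩

end TwistedTropicalCover

/-! ### The weighted number of connected lifts -/

namespace TropicalCover

variable {E : TropicalEllipticCurve} {B : Finset (AddCircle E.len)} {C : TropicalCover E}

/-- The mass of the connected lifts, in terms of gluings. -/
theorem sum_connectedLiftClass (hC : C.IsTwistedQuotient B) :
    Finite (C.ConnectedLiftClass B) ∧
      ∑ᶠ π : C.ConnectedLiftClass B, (1 : ℚ) / π.autCard =
        Nat.card {x : C.Gluing B // (x.twisted hC).Connected} /
          (C.autCard * (2 ^ C.freeCard B * 2 ^ Fintype.card C.Edge)) := by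
  classical
  let cl : {x : C.Gluing B // (x.twisted hC).Connected} → C.ConnectedLiftClass B := fun x =>
    Quotient.mk _ ⟨x.1.twisted hC, x.2, ⟨x.1.twistedQuotientIso hC⟩⟩
  have hcl : Function.Surjective cl := by
    rintro ⟨P, hP, ⟨φ⟩⟩
    obtain ⟨x, ⟨f⟩⟩ := TwistedTropicalCover.exists_gluing hC φ
    exact ⟨⟨x, f.symm.connected hP⟩, Quotient.sound ⟨f⟩⟩
  have hfin : Finite (C.ConnectedLiftClass B) := Finite.of_surjective cl hcl
  refine ⟨hfin, ?_⟩
  have := Fintype.ofFinite (C.ConnectedLiftClass B)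
  have := Fintype.ofFinite {x : C.Gluing B // (x.twisted hC).Connected}
  rw [finsum_eq_sum_of_fintype, Nat.card_eq_fintype_card, ← Finset.card_univ,
    Finset.card_eq_sum_card_fiberwise (f := cl) (t := Finset.univ) (fun _ _ => by simp),
    Nat.cast_sum, Finset.sum_div]
  refine Finset.sum_congr rfl fun π _ => ?_
  obtain ⟨P, hP, ⟨φ⟩⟩ := π
  have h := TwistedTropicalCover.card_gluing_mul_autCard hC φ
  -- A gluing whose cover is isomorphic to the connected `P` is automatically connected, so the
  -- fiber of `cl` contains all gluings yielding `P`.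
  have h2 : Nat.card {x : C.Gluing B // Nonempty (TwistedTropicalCover.Iso (x.twisted hC) P)} =
      (Finset.univ.filter fun x => cl x = Quotient.mk _ ⟨P, hP, ⟨φ⟩⟩).card := by
    rw [← Fintype.card_subtype, ← Nat.card_eq_fintype_card]
    refine Nat.card_congr
      { toFun := fun x => ⟨⟨x.1, x.2.some.symm.connected hP⟩, Quotient.sound x.2⟩
        invFun := fun x => ⟨x.1.1, Quotient.exact x.2⟩
        left_inv := fun _ => rfl
        right_inv := fun _ => rfl }
  rw [h2] at h
  have hP0 : (P.autCard : ℚ) ≠ 0 := Nat.cast_ne_zero.2 P.autCard_pos.ne'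
  have hC0 : (C.autCard : ℚ) ≠ 0 := Nat.cast_ne_zero.2 C.autCard_pos.ne'
  refine (div_eq_div_iff hP0 (by positivity)).2 ?_
  rw [one_mul]
  exact_mod_cast h.symm

end TropicalCover

/-! ### Connectedness and the Euler characteristic of a graph -/

namespace MetricGraph

variable (Γ : MetricGraph)

/-- Two vertices are joined by an undirected path. -/
def Joined (v w : Γ.Vert) : Prop :=
  Relation.EqvGen (fun a b => ∃ e, Γ.src e = a ∧ Γ.tgt e = b) v w

variable {Γ}

theorem Joined.edge (e : Γ.Edge) : Γ.Joined (Γ.src e) (Γ.tgt e) := .rel _ _ ⟨e, rfl, rfl⟩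

theorem Joined.refl (v : Γ.Vert) : Γ.Joined v v :=
  Relation.EqvGen.refl v

theorem Joined.symm {v w : Γ.Vert} (h : Γ.Joined v w) : Γ.Joined w v :=
  Relation.EqvGen.symm _ _ h

theorem Joined.trans {u v w : Γ.Vert} (h : Γ.Joined u v) (h' : Γ.Joined v w) : Γ.Joined u w :=
  Relation.EqvGen.trans _ _ _ h h'

theorem Joined.apply_eq {α : Type*} {k : Γ.Vert → α} (hk : ∀ e, k (Γ.src e) = k (Γ.tgt e))
    {v w : Γ.Vert} (h : Γ.Joined v w) : k v = k w := by
  induction h with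
  | rel a b hab =>
    obtain ⟨e, rfl, rfl⟩ := hab
    exact hk e
  | refl => rfl
  | symm _ _ _ ih => exact ih.symm
  | trans _ _ _ _ _ ih ih' => exact ih.trans ih'

/-- The first Betti number of a connected graph. -/
theorem Connected.genus_add_card_vert (h : Γ.Connected) :
    Γ.genus + Fintype.card Γ.Vert = Fintype.card Γ.Edge + 1 := by
  classical
  obtain ⟨⟨v₀⟩, hjoin⟩ := h
  let S : (Γ.Vert → ℚ) →ₗ[ℚ] ℚ := ∑ v, LinearMap.proj v
  have hS : ∀ f, S f = ∑ v, f v := fun f => by simp [S]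
  -- For a connected graph the image of the boundary is the kernel of the augmentation `S`, hence of
  -- codimension one: a path from `v` to `w` exhibits their difference as a boundary, and such
  -- differences span the kernel. Rank–nullity for both maps then gives the formula.
  have hrange : LinearMap.range Γ.boundary = LinearMap.ker S := by
    apply le_antisymm
    · rintro _ ⟨x, rfl⟩
      rw [LinearMap.mem_ker, hS]
      change ∑ v, ((∑ e with Γ.tgt e = v, x e) - ∑ e with Γ.src e = v, x e) = 0
      rw [Finset.sum_sub_distrib, Finset.sum_fiberwise (g := Γ.tgt),
        Finset.sum_fiberwise (g := Γ.src), sub_self]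
    · have single : ∀ v w, Γ.Joined v w →
          (Pi.single w 1 - Pi.single v 1 : Γ.Vert → ℚ) ∈ LinearMap.range Γ.boundary := by
        intro v w hvw
        induction hvw with
        | rel a b hab =>
          obtain ⟨e, rfl, rfl⟩ := hab
          refine ⟨Pi.single e 1, ?_⟩
          funext v
          change (∑ e' with Γ.tgt e' = v, (Pi.single e 1 : Γ.Edge → ℚ) e') -
            ∑ e' with Γ.src e' = v, (Pi.single e 1 : Γ.Edge → ℚ) e' = _
          simp [Pi.single_apply, eq_comm]
        | refl => simp
        | symm _ _ _ ih =>
          rw [← neg_sub]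
          exact Submodule.neg_mem _ ih
        | trans _ _ _ _ _ ih ih' =>
          rw [← sub_add_sub_cancel]
          exact Submodule.add_mem _ ih' ih
      intro f hf
      rw [LinearMap.mem_ker, hS] at hf
      have : f = ∑ v, f v • (Pi.single v 1 - Pi.single v₀ 1 : Γ.Vert → ℚ) := by
        simp only [smul_sub, Finset.sum_sub_distrib, ← Finset.sum_smul, hf, zero_smul, sub_zero]
        exact pi_eq_sum_univ' f
      rw [this]
      exact Submodule.sum_mem _ fun v _ => Submodule.smul_mem _ _ (single _ _ (hjoin v₀ v))
  have hsurj : LinearMap.range S = ⊤ := by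
    rw [LinearMap.range_eq_top]
    intro a
    exact ⟨Pi.single v₀ a, by rw [hS]; simp⟩
  have h1 := Γ.boundary.finrank_range_add_finrank_ker
  have h2 := S.finrank_range_add_finrank_ker
  rw [hsurj, finrank_top, Module.finrank_self, Module.finrank_fintype_fun_eq_card] at h2
  rw [hrange, Module.finrank_fintype_fun_eq_card] at h1
  rw [genus]
  omega

end MetricGraph

/-! ### Connectedness of a twisted cover -/

namespace TwistedTropicalCover

variable {E : TropicalEllipticCurve} {B : Finset (AddCircle E.len)} {C : TropicalCover E}
  {P : TwistedTropicalCover E B}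

theorem joined_ι {v w : P.Vert} (h : P.Joined v w) : P.Joined (P.ι.vert v) (P.ι.vert w) := by
  induction h with
  | rel a b hab =>
    obtain ⟨e, rfl, rfl⟩ := hab
    rw [← P.ι.src_edge, ← P.ι.tgt_edge]
    exact .edge _
  | refl => exact .refl _
  | symm _ _ _ ih => exact ih.symm
  | trans _ _ _ _ _ ih ih' => exact ih.trans ih'

theorem joined_ι_left {v w : P.Vert} (h : P.Joined v (P.ι.vert w)) :
    P.Joined (P.ι.vert v) w := by
  simpa only [P.ι_vert_ι_vert] using joined_ι h

/-- A path in `C` lifts from any starting vertex, with its end determined up to the involution.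
Hence a lift of a connected graph has at most two components. -/
theorem joined_or_joined_ι (φ : TropicalCover.Iso P.quotient C) {v v' : C.Vert}
    (h : C.Joined v v') (w w' : P.Vert) (hw : vertMap φ w = v) (hw' : vertMap φ w' = v') :
    P.Joined w w' ∨ P.Joined w (P.ι.vert w') := by
  induction h generalizing w w' with
  | rel a b hab =>
    obtain ⟨e, rfl, rfl⟩ := hab
    obtain ⟨d, rfl⟩ := edgeMap_surjective φ e
    rw [← vertMap_src, eq_comm, vertMap_eq_iff] at hw
    rw [← vertMap_tgt, eq_comm, vertMap_eq_iff] at hw'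
    have h1 := MetricGraph.Joined.edge (Γ := P.toMetricGraph) d
    have h2 := joined_ι h1
    have h3 := P.ι_vert_ι_vert (P.tgt d)
    rcases hw with rfl | rfl <;> rcases hw' with rfl | rfl
    · exact Or.inl h1
    · exact Or.inr (by rwa [h3])
    · exact Or.inr h2
    · exact Or.inl h2
  | refl a =>
    rcases (vertMap_eq_iff φ w w').1 (hw.trans hw'.symm) with rfl | rfl
    · exact Or.inl (.refl _)
    · exact Or.inr (by rw [P.ι_vert_ι_vert]; exact .refl _)
  | symm a b _ ih => exact (ih w' w hw' hw).imp (·.symm) fun h => (joined_ι_left h).symm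
  | trans a b c _ _ ih ih' =>
    obtain ⟨u, hu⟩ := vertMap_surjective φ b
    rcases ih w u hw hu with h | h <;> rcases ih' u w' hu hw' with h' | h'
    · exact Or.inl (h.trans h')
    · exact Or.inr (h.trans h')
    · exact Or.inr (h.trans (joined_ι h'))
    · exact Or.inl (h.trans (joined_ι_left h'))

/-- A twisted cover with connected quotient is disconnected if and only if it is split, that is,
there is a locally constant function to `ZMod 2` that changes under the involution. -/
theorem not_connected_iff (φ : TropicalCover.Iso P.quotient C) (hC : C.Connected) :
    ¬ P.Connected ↔ ∃ k : P.Vert → ZMod 2, (∀ e, k (P.src e) = k (P.tgt e)) ∧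
      ∀ w, k (P.ι.vert w) = k w + 1 := by
  classical
  obtain ⟨v₀⟩ := hC.1
  obtain ⟨w₀, -⟩ := vertMap_surjective φ v₀
  have hor : ∀ w w', P.Joined w w' ∨ P.Joined w (P.ι.vert w') := fun w w' =>
    joined_or_joined_ι φ (hC.2 _ _) w w' rfl rfl
  constructor
  · intro hP
    refine ⟨fun w => if P.Joined w₀ w then 0 else 1, fun e => ?_, fun w => ?_⟩
    · have he := MetricGraph.Joined.edge (Γ := P.toMetricGraph) e
      simp only [show P.Joined w₀ (P.src e) ↔ P.Joined w₀ (P.tgt e) from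
        ⟨fun h => h.trans he, fun h => h.trans he.symm⟩]
    · by_cases h1 : P.Joined w₀ w <;> by_cases h2 : P.Joined w₀ (P.ι.vert w)
      · refine absurd ⟨⟨w₀⟩, fun a b => ?_⟩ hP
        have all : ∀ u, P.Joined w u := fun u => by
          rcases hor w u with h | h
          · exact h
          · exact (h1.symm.trans h2).trans (joined_ι_left h)
        exact (all a).symm.trans (all b)
      · simp [h1, h2]
      · simp only [h1, h2, if_true, if_false]
        rfl
      · exact absurd (hor w₀ w) (by tauto)
  · rintro ⟨k, hk, hι⟩ hP
    have h1 := MetricGraph.Joined.apply_eq hk (hP.2 (P.ι.vert w₀) w₀)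
    rw [hι, add_eq_left] at h1
    exact one_ne_zero h1

/-- A splitting function would have to change its value at a fixed vertex. -/
theorem connected_of_ramified (φ : TropicalCover.Iso P.quotient C) (hC : C.Connected)
    {v : C.Vert} (hv : C.Ramified B v) : P.Connected := by
  by_contra hP
  obtain ⟨k, -, hι⟩ := (not_connected_iff φ hC).1 hP
  obtain ⟨w, rfl⟩ := vertMap_surjective φ v
  have := hι w
  rw [(ι_vert_eq_iff_ramified φ w).2 hv, left_eq_add] at this
  exact one_ne_zero this

end TwistedTropicalCover

/-! ### Counting all gluings and the disconnected ones -/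

namespace TropicalCover

variable {E : TropicalEllipticCurve} {B : Finset (AddCircle E.len)} {C : TropicalCover E}

theorem freeCard_add_twoValentCard (C : TropicalCover E) (B : Finset (AddCircle E.len)) :
    C.freeCard B + C.twoValentCard B = Fintype.card C.Vert := by
  classical
  rw [freeCard, ← Nat.card_eq_fintype_card, add_comm]
  exact Nat.card_sum.symm.trans (Nat.card_congr (Equiv.sumCompl (C.Ramified B)))

theorem card_sheet (C : TropicalCover E) (v : C.Vert) [Decidable (C.Ramified B v)] :
    Nat.card (C.Sheet B v) = if C.Ramified B v then 1 else 2 := by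
  have hall : ∀ z : C.Sheet B v, z = .zero C B v ∨ z = (Sheet.zero C B v).add 1 :=
    fun z => Sheet.eq_or_eq _ _
  split_ifs with h
  · rw [Nat.card_eq_one_iff_unique]
    refine ⟨⟨fun a b => ?_⟩, ⟨.zero C B v⟩⟩
    have ha := hall a
    have hb := hall b
    rw [(Sheet.add_one_eq_iff _).2 h, or_self] at ha hb
    exact ha.trans hb.symm
  · rw [Nat.card_eq_two_iff]
    exact ⟨_, _, fun h' => h ((Sheet.add_one_eq_iff _).1 h'.symm),
      Set.eq_univ_iff_forall.2 hall⟩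

/-- Taken with `s` the source or the target map. Each ramified vertex is hit by exactly one edge, so
as many factors drop from 2 to 1 as there are ramified vertices. -/
theorem prod_card_sheet (C : TropicalCover E) (B : Finset (AddCircle E.len))
    (s : C.Edge → C.Vert) [∀ v, DecidablePred fun e => s e = v]
    (hs : ∀ v, C.valency v = 2 → (Finset.univ.filter fun e => s e = v).card = 1) :
    (∏ e, Nat.card (C.Sheet B (s e))) * 2 ^ C.twoValentCard B = 2 ^ Fintype.card C.Edge := by
  classical
  simp only [card_sheet]
  have hc : (Finset.univ.filter fun e => C.Ramified B (s e)).card = C.twoValentCard B := by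
    rw [Finset.card_eq_sum_card_fiberwise (f := s)
      (t := Finset.univ.filter fun v => C.Ramified B v) (fun e he => by simpa using he),
      show C.twoValentCard B = Nat.card {v // C.Ramified B v} from rfl,
      Nat.card_eq_fintype_card, Fintype.card_subtype, Finset.card_eq_sum_ones]
    refine Finset.sum_congr rfl fun v hv => ?_
    have hv := (Finset.mem_filter.1 hv).2
    rw [Finset.filter_filter, ← hs v hv.1]
    congr 1
    ext e
    simp only [Finset.mem_filter, Finset.mem_univ, true_and, and_iff_right_iff_imp]
    rintro rfl
    exact hv
  rw [Finset.prod_ite, Finset.prod_const_one, one_mul, Finset.prod_const, ← hc, ← pow_add,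
    add_comm, Finset.card_filter_add_card_filter_not, Finset.card_univ]

theorem card_gluing (C : TropicalCover E) (B : Finset (AddCircle E.len)) :
    Nat.card (C.Gluing B) * 2 ^ (2 * C.twoValentCard B) = 2 ^ (2 * Fintype.card C.Edge) := by
  classical
  have e : C.Gluing B ≃ (∀ e, C.Sheet B (C.src e)) × (∀ e, C.Sheet B (C.tgt e)) :=
    { toFun := fun x => (x.src, x.tgt)
      invFun := fun x => ⟨x.1, x.2⟩
      left_inv := fun _ => rfl
      right_inv := fun _ => rfl }
  rw [Nat.card_congr e, Nat.card_prod, Nat.card_pi, Nat.card_pi, two_mul, two_mul, pow_add,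
    pow_add, mul_mul_mul_comm, C.prod_card_sheet B C.src, C.prod_card_sheet B C.tgt]
  · intro v hv
    convert (C.card_src_eq_one hv).2
  · intro v hv
    convert (C.card_src_eq_one hv).1

/-- The gluing of sheets given by a labelling of the vertices and edges. -/
def splitGluing (C : TropicalCover E) : (C.Vert → ZMod 2) × (C.Edge → ZMod 2) →+
    (C.Edge → ZMod 2) × (C.Edge → ZMod 2) where
  toFun p := (fun e => p.1 (C.src e) + p.2 e, fun e => p.1 (C.tgt e) + p.2 e)
  map_zero' := by ext <;> simp
  map_add' p q := by ext <;> simp <;> ring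

/-- In characteristic two, an element of the kernel has on each edge the label of both its ends; by
connectedness all labels agree. -/
theorem card_ker_splitGluing (hC : C.Connected) : Nat.card C.splitGluing.ker = 2 := by
  obtain ⟨v₀⟩ := hC.1
  have hmem : ∀ z : ZMod 2, ((fun _ => z, fun _ => z) : (C.Vert → ZMod 2) × (C.Edge → ZMod 2)) ∈
      C.splitGluing.ker := fun z => by
    rw [AddMonoidHom.mem_ker]
    ext <;> exact CharTwo.add_self_eq_zero z
  have hb : Function.Bijective fun z : ZMod 2 => (⟨_, hmem z⟩ : C.splitGluing.ker) := by
    constructor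
    · intro z z' h
      exact congrFun (congrArg (fun p => p.1.1) h) v₀
    · rintro ⟨⟨k, b⟩, h⟩
      rw [AddMonoidHom.mem_ker] at h
      have h1 : ∀ e, k (C.src e) + b e = 0 := congrFun (congrArg Prod.fst h)
      have h2 : ∀ e, k (C.tgt e) + b e = 0 := congrFun (congrArg Prod.snd h)
      have hk : ∀ v, k v₀ = k v := fun v => MetricGraph.Joined.apply_eq
        (fun e => add_right_cancel ((h1 e).trans (h2 e).symm)) (hC.2 v₀ v)
      refine ⟨k v₀, Subtype.ext (Prod.ext (funext hk) (funext fun e => ?_))⟩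
      have := h1 e
      rw [← hk] at this
      exact CharTwo.add_eq_zero.1 this
  rw [← Nat.card_congr (Equiv.ofBijective _ hb), Nat.card_zmod]

theorem Sheet.add_val_of_not_ramified {v : C.Vert} (hv : ¬ C.Ramified B v) (z : C.Sheet B v)
    (i : ZMod 2) : (z.add i).1 = z.1 + i := by
  have h : C.coeff B v = 1 := if_neg hv
  exact (congrArg (fun c => z.1 + c * i) h).trans (by rw [one_mul])

/-- If no vertex is ramified, a gluing defines a disconnected cover if and only if it comes from
a labelling of the vertices and edges. -/
theorem Gluing.not_connected_iff (hq : C.IsTwistedQuotient B) (hC : C.Connected)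
    (hr : ∀ v, ¬ C.Ramified B v) (x : C.Gluing B) :
    ¬ (x.twisted hq).Connected ↔
      ((fun e => (x.src e).1, fun e => (x.tgt e).1) :
        (C.Edge → ZMod 2) × (C.Edge → ZMod 2)) ∈ C.splitGluing.range := by
  rw [TwistedTropicalCover.not_connected_iff (x.twistedQuotientIso hq) hC]
  have hadd : ∀ v (z : C.Sheet B v) i, (z.add i).1 = z.1 + i := fun v z i =>
    z.add_val_of_not_ramified (hr v) i
  constructor
  · rintro ⟨k, hk, hι⟩
    let k' : Vert C B → ZMod 2 := k
    have hkz : ∀ v (z : C.Sheet B v), k' ⟨v, z⟩ = k' ⟨v, .zero C B v⟩ + z.1 := by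
      intro v z
      rcases (Sheet.zero C B v).eq_or_eq z with rfl | rfl
      · exact (add_zero _).symm
      · rw [hadd]
        refine (hι (⟨v, .zero C B v⟩ : Vert C B)).trans ?_
        simp only [Sheet.zero, zero_add]
        rfl
    have hke : ∀ e, k' ⟨C.src e, x.src e⟩ = k' ⟨C.tgt e, x.tgt e⟩ := fun e => by
      rw [← (x.src e).add_zero, ← (x.tgt e).add_zero]
      exact hk ((e, 0) : C.Edge × ZMod 2)
    -- A vertex is labelled by the value of `k'` on its zero sheet, an edge by the common value at
    -- both ends of its zero sheet. Conversely, a labelling `k` defines the splitting function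
    -- sending the sheet `z` over `v` to `k v + z`.
    refine ⟨(fun v => k' ⟨v, .zero C B v⟩, fun e => k' ⟨C.src e, x.src e⟩), ?_⟩
    ext e
    · change k' _ + k' _ = _
      rw [hkz _ (x.src e), CharTwo.add_cancel_left]
    · change k' _ + k' _ = _
      rw [hke, hkz _ (x.tgt e), CharTwo.add_cancel_left]
  · rintro ⟨⟨k, b⟩, h⟩
    have h1 : ∀ e, k (C.src e) + b e = (x.src e).1 := congrFun (congrArg Prod.fst h)
    have h2 : ∀ e, k (C.tgt e) + b e = (x.tgt e).1 := congrFun (congrArg Prod.snd h)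
    refine ⟨fun w : Vert C B => k w.1 + w.2.1, fun a : C.Edge × ZMod 2 => ?_,
      fun w : Vert C B => ?_⟩
    · change k (C.src a.1) + ((x.src a.1).add a.2).1 = k (C.tgt a.1) + ((x.tgt a.1).add a.2).1
      rw [hadd, hadd, ← h1, ← h2, add_assoc, CharTwo.add_cancel_left, add_assoc,
        CharTwo.add_cancel_left]
    · change k w.1 + (w.2.add 1).1 = k w.1 + w.2.1 + 1
      rw [hadd, add_assoc]

theorem card_not_connected (hq : C.IsTwistedQuotient B) (hC : C.Connected)
    (hr : ∀ v, ¬ C.Ramified B v) :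
    Nat.card {x : C.Gluing B // ¬ (x.twisted hq).Connected} * 2 =
      2 ^ (Fintype.card C.Vert + Fintype.card C.Edge) := by
  -- The index of the kernel is the size of the image. Without ramification every sheet set is all
  -- of `ZMod 2`, so each element of the image is a gluing.
  have h := C.splitGluing.ker.card_mul_index
  rw [AddSubgroup.index_ker, card_ker_splitGluing hC, Nat.card_prod, Nat.card_fun, Nat.card_fun,
    Nat.card_zmod, Nat.card_eq_fintype_card (α := C.Vert), Nat.card_eq_fintype_card (α := C.Edge),
    ← pow_add, mul_comm] at h
  rw [← h]
  congr 1
  have hone : ∀ v, C.coeff B v = 1 := fun v => if_neg (hr v)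
  refine Nat.card_congr
    { toFun := fun x => ⟨_, (x.1.not_connected_iff hq hC hr).1 x.2⟩
      invFun := fun p => ⟨⟨fun e => ⟨p.1.1 e, by rw [hone, one_mul]⟩,
        fun e => ⟨p.1.2 e, by rw [hone, one_mul]⟩⟩,
        (Gluing.not_connected_iff hq hC hr _).2 p.2⟩
      left_inv := fun _ => rfl
      right_inv := fun _ => rfl }

end TropicalCover

/-! ### The mass formula -/

theorem proposition2 (E : TropicalEllipticCurve) (B : Finset (AddCircle E.len))
    (C : TropicalCover E) (hconn : C.Connected)
    (hquot : ∃ P : TwistedTropicalCover E B, Nonempty (TropicalCover.Iso P.quotient C)) :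
    Finite (C.ConnectedLiftClass B) ∧
      ∑ᶠ π : C.ConnectedLiftClass B, (1 : ℚ) / π.autCard =
        (2 ^ C.genus - if C.twoValentCard B = 0 then 1 else 0) /
          (2 ^ (C.twoValentCard B + 1) * C.autCard) := by
  classical
  obtain ⟨P, ⟨φ⟩⟩ := hquot
  have hq := TwistedTropicalCover.isTwistedQuotient φ
  obtain ⟨hfin, hsum⟩ := TropicalCover.sum_connectedLiftClass hq
  refine ⟨hfin, hsum.trans ?_⟩
  have hgenus := hconn.genus_add_card_vert
  have hvert := C.freeCard_add_twoValentCard B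
  have hglue := C.card_gluing B
  have haut : (C.autCard : ℚ) ≠ 0 := Nat.cast_ne_zero.2 C.autCard_pos.ne'
  rw [div_eq_div_iff (by positivity) (by positivity)]
  split_ifs with hc
  · have hr : ∀ v, ¬ C.Ramified B v := fun v hv =>
      haveI : Nonempty {v // C.valency v = 2 ∧ C.proj v ∈ B} := ⟨⟨v, hv⟩⟩
      Nat.card_pos.ne' hc
    have hdis := TropicalCover.card_not_connected hq hconn hr
    have hsplit : Nat.card {x : C.Gluing B // (x.twisted hq).Connected} +
        Nat.card {x : C.Gluing B // ¬ (x.twisted hq).Connected} = Nat.card (C.Gluing B) := by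
      rw [← Nat.card_sum]
      exact Nat.card_congr (Equiv.sumCompl _)
    rw [hc, mul_zero, pow_zero, mul_one, ← hsplit] at hglue
    rw [hc, add_zero] at hvert
    rw [hc, hvert, zero_add, pow_one]
    have key : (2 : ℚ) ^ C.genus * 2 ^ Fintype.card C.Vert = 2 ^ Fintype.card C.Edge * 2 := by
      rw [← pow_add, hgenus, pow_succ]
    have hdis' : (Nat.card {x : C.Gluing B // ¬ (x.twisted hq).Connected} : ℚ) * 2 =
        2 ^ Fintype.card C.Vert * 2 ^ Fintype.card C.Edge := by
      rw [← pow_add]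
      exact_mod_cast hdis
    have hglue' : (Nat.card {x : C.Gluing B // (x.twisted hq).Connected} : ℚ) +
        Nat.card {x : C.Gluing B // ¬ (x.twisted hq).Connected} =
          2 ^ Fintype.card C.Edge * 2 ^ Fintype.card C.Edge := by
      rw [← pow_add, ← two_mul]
      exact_mod_cast hglue
    linear_combination (C.autCard : ℚ) * (2 * hglue' - hdis' - 2 ^ Fintype.card C.Edge * key)
  · obtain ⟨⟨v, hv⟩, -⟩ := Nat.card_pos_iff.1 (Nat.pos_of_ne_zero hc)
    have hall : Nat.card {x : C.Gluing B // (x.twisted hq).Connected} = Nat.card (C.Gluing B) :=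
      Nat.card_congr (Equiv.subtypeUnivEquiv fun x =>
        TwistedTropicalCover.connected_of_ramified (x.twistedQuotientIso hq) hconn hv)
    rw [hall, sub_zero]
    have hglue' : (Nat.card (C.Gluing B) : ℚ) * (2 ^ C.twoValentCard B * 2 ^ C.twoValentCard B) =
        2 ^ Fintype.card C.Edge * 2 ^ Fintype.card C.Edge := by
      rw [← pow_add, ← pow_add, ← two_mul, ← two_mul]
      exact_mod_cast hglue
    have key : (2 : ℚ) ^ C.genus * (2 ^ C.freeCard B * 2 ^ C.twoValentCard B) =
        2 ^ Fintype.card C.Edge * 2 := by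
      rw [← pow_add, ← pow_add, hvert, hgenus, pow_succ]
    have hne : (2 : ℚ) ^ C.twoValentCard B ≠ 0 := by positivity
    -- The extra factor supplies the powers of two needed by both `hglue'` and `key`, so that no
    -- division or subtraction of exponents is needed.
    apply mul_right_cancel₀ hne
    rw [pow_succ]
    linear_combination (C.autCard : ℚ) * (2 * hglue' - 2 ^ Fintype.card C.Edge * key)
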